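/- Let $N\ge 2$, let $\omega\subset\mathbb R^{N-1}$ be a smooth bounded domain, and put $\Omega_\omega=\omega\times(0,1)$, $\Gamma_0=\omega\times\{1\}$, $\Gamma=\partial\Omega_\omega\setminus\overline{\Gamma_0}$; write $x=(x',x_N)$. Let $H^1_0(\Omega_\omega\cup\Gamma)$ be the space of functions in $H^1(\Omega_\omega)$ whose trace vanishes on $\Gamma_0$, and $H^1_{0,x_N}(\Omega_\omega\cup\Gamma)$ its subspace of functions depending only on $x_N$. Let $f\in C^{1,\beta}(\mathbb R)$, $\beta\in(0,1)$, satisfy $f'(s)>f(s)/s$ and $s f(s)>0$ for all $s\ne 0$. Let $u_\omega(x',x_N)=\widetilde u(x_N)$, with $\widetilde u$ continuous on $(0,1)$, be a nontrivial one-dimensional weak solution of $$-\Delta u=f(u)\ \text{in }\Omega_\omega,\qquad u=0\ \text{on }\Gamma_0,\qquad \frac{\partial u}{\partial\nu}=0\ \text{on }\Gamma,$$ that is, $u_\omega\in H^1_0(\Omega_\omega\cup\Gamma)$ and $\int_{\Omega_\omega}\nabla u_\omega\cdot\nabla v-\int_{\Omega_\omega}f(u_\omega)v=0$ for all $v\in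 H^1_0(\Omega_\omega\cup\Gamma)$. Then: 1. $u_\omega$ is nondegenerate in $H^1_{0,x_N}(\Omega_\omega\cup\Gamma)$: if $\varphi\in H^1_{0,x_N}(\Omega_\omega\cup\Gamma)$ satisfies $\int_{\Omega_\omega}\nabla\varphi\cdot\nabla v-\int_{\Omega_\omega}f'(u_\omega)\varphi v=0$ for all $v\in H^1_{0,x_N}(\Omega_\omega\cup\Gamma)$, then $\varphi=0$. 2. $0$ is not an eigenvalue of the problem $$-z''-f'(\widetilde u)z=\alpha z\ \text{in }(0,1),\qquad z'(0)=z(1)=0.$$ 3. The number $n$ of nodal domains of $u_\omega$ (connected components of $\{x\in\Omega_\omega: u_\omega(x)\neq0\}$) is finite, the eigenvalues of the problem in 2 form an infinite sequence $\alpha_1<\alpha_2<\cdots$, and $\alpha_{n+1}>0$. -/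

import Mathlib

open MeasureTheory Set

namespace Cylinder

/-- A point `x = (x', x_N)` of `ℝ^N = ℝ^d × ℝ`, where `d = N - 1`. -/
abbrev Pt (d : ℕ) : Type := EuclideanSpace ℝ (Fin d) × ℝ

variable {d : ℕ}

/-- The Euclidean scalar product of `ℝ^N` in the splitting `ℝ^d × ℝ`. -/
noncomputable def dot (a b : Pt d) : ℝ := inner ℝ a.1 b.1 + a.2 * b.2

/-- The half-cylinder `Σ_ω = ω × (0, ∞)`. -/
def halfCylinder (ω : Set (EuclideanSpace ℝ (Fin d))) : Set (Pt d) := ω ×ˢ Ioi (0 : ℝ)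

/-- The bounded cylinder `Ω_ω = ω × (0, 1)`. -/
def cylinder (ω : Set (EuclideanSpace ℝ (Fin d))) : Set (Pt d) := ω ×ˢ Ioo (0 : ℝ) 1

/-- `φ ∈ C_c^∞(O)`. -/
def IsTestFunction (O : Set (Pt d)) (φ : Pt d → ℝ) : Prop :=
  ContDiff ℝ ((⊤ : ℕ∞) : WithTop ℕ∞) φ ∧ HasCompactSupport φ ∧ tsupport φ ⊆ O

/-- `u ∈ H¹(O)` with weak gradient `G`. -/
structure IsH1 (O : Set (Pt d)) (u : Pt d → ℝ) (G : Pt d → Pt d) : Prop where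
  memLp : MemLp u 2 (volume.restrict O)
  memLp_grad : MemLp G 2 (volume.restrict O)
  weakGrad : ∀ φ, IsTestFunction O φ → ∀ e : Pt d,
    ∫ x in O, u x * fderiv ℝ φ x e = - ∫ x in O, dot (G x) e * φ x

/-- For `u ∈ H¹(Ω_ω)` with weak gradient `G`: the trace of `u` on the top `Γ₀ = ω × {1}` is
`γ ∈ L¹_loc(ω)`, expressed by Green's formula against all smooth functions with compact support
in the open half-cylinder. These may be nonzero on `Γ₀`, but vanish near the remaining
part `Γ` of the boundary of `Ω_ω`. -/
def HasTopTrace (ω : Set (EuclideanSpace ℝ (Fin d))) (u : Pt d → ℝ) (G : Pt d → Pt d)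
    (γ : EuclideanSpace ℝ (Fin d) → ℝ) : Prop :=
  LocallyIntegrableOn γ ω ∧
  ∀ φ, IsTestFunction (halfCylinder ω) φ →
    ∫ x in cylinder ω, u x * fderiv ℝ φ x (0, 1) =
      (∫ y in ω, γ y * φ (y, 1)) - ∫ x in cylinder ω, (G x).2 * φ x

/-- `u ∈ H¹₀(Ω_ω ∪ Γ)`, with weak gradient `G`: the functions in `H¹(Ω_ω)` whose trace
vanishes on `Γ₀`. -/
def IsH10 (ω : Set (EuclideanSpace ℝ (Fin d))) (u : Pt d → ℝ) (G : Pt d → Pt d) : Prop :=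
  IsH1 (cylinder ω) u G ∧ HasTopTrace ω u G (fun _ => 0)

/-- `u` depends (almost everywhere in `Ω_ω`) only on the variable `x_N`. -/
def IsOneDim (ω : Set (EuclideanSpace ℝ (Fin d))) (u : Pt d → ℝ) : Prop :=
  ∃ w : ℝ → ℝ, ∀ᵐ x ∂(volume.restrict (cylinder ω)), u x = w x.2

/-- `u ∈ H¹_{0,x_N}(Ω_ω ∪ Γ)`, with weak gradient `G`. -/
def IsH10OneDim (ω : Set (EuclideanSpace ℝ (Fin d))) (u : Pt d → ℝ) (G : Pt d → Pt d) : Prop :=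
  IsH10 ω u G ∧ IsOneDim ω u

/-- `u` is a weak solution of `-Δu = f(u)` in `Ω_ω`, `u = 0` on `Γ₀`, `∂u/∂ν = 0` on `Γ`. -/
def IsWeakSolution (ω : Set (EuclideanSpace ℝ (Fin d))) (f : ℝ → ℝ) (u : Pt d → ℝ) : Prop :=
  ∃ G, IsH10 ω u G ∧ ∀ v H, IsH10 ω v H →
    IntegrableOn (fun x => f (u x) * v x) (cylinder ω) ∧
    (∫ x in cylinder ω, dot (G x) (H x)) - ∫ x in cylinder ω, f (u x) * v x = 0

/-- `φ ∈ H¹_{0,x_N}(Ω_ω ∪ Γ)` solves the linearized equation `L_u φ = -Δφ - f'(u) φ = 0`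
weakly in the space `H¹_{0,x_N}(Ω_ω ∪ Γ)`. -/
def IsLinearizedSolution (ω : Set (EuclideanSpace ℝ (Fin d))) (f : ℝ → ℝ) (u φ : Pt d → ℝ) :
    Prop :=
  ∃ G, IsH10OneDim ω φ G ∧ ∀ v H, IsH10OneDim ω v H →
    IntegrableOn (fun x => deriv f (u x) * φ x * v x) (cylinder ω) ∧
    (∫ x in cylinder ω, dot (G x) (H x)) -
      ∫ x in cylinder ω, deriv f (u x) * φ x * v x = 0

/-- `u` is nondegenerate in `H¹_{0,x_N}(Ω_ω ∪ Γ)`: zero is not an eigenvalue of `L_u` there. -/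
def IsNondegenerateOneDim (ω : Set (EuclideanSpace ℝ (Fin d))) (f : ℝ → ℝ) (u : Pt d → ℝ) :
    Prop :=
  ∀ φ, IsLinearizedSolution ω f u φ → ∀ᵐ x ∂(volume.restrict (cylinder ω)), φ x = 0

/-- The number `n(u)` of nodal domains: the connected components of `{x ∈ Ω_ω : u(x) ≠ 0}`. -/
noncomputable def nodalCount (ω : Set (EuclideanSpace ℝ (Fin d))) (u : Pt d → ℝ) : ℕ∞ :=
  ENat.card (ConnectedComponents {x : Pt d // x ∈ cylinder ω ∧ u x ≠ 0})

/-- The function `(x', x_N) ↦ U(x_N)`. -/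
def lift (d : ℕ) (U : ℝ → ℝ) : Pt d → ℝ := fun x => U x.2

/-- `a` is an eigenvalue of `-z'' - f'(U) z = a z` in `(0, 1)`, `z'(0) = z(1) = 0`; here `z'`
is the function `w`, and `z, z'` are continuous up to the end points. -/
def IsEigenvalue (f U : ℝ → ℝ) (a : ℝ) : Prop :=
  ∃ z w : ℝ → ℝ, ContinuousOn z (Icc 0 1) ∧ ContinuousOn w (Icc 0 1) ∧
    (∀ t ∈ Ioo (0 : ℝ) 1, HasDerivAt z (w t) t) ∧
    (∀ t ∈ Ioo (0 : ℝ) 1, ∃ w' : ℝ, HasDerivAt w w' t ∧ -w' - deriv f (U t) * z t = a * z t) ∧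
    w 0 = 0 ∧ z 1 = 0 ∧ ∃ t ∈ Ioo (0 : ℝ) 1, z t ≠ 0

end Cylinder

/-!
The mean value of the weak equation over the cross section shows that the profile of a
one-dimensional weak solution, of the nonlinear or of the linearized problem, is a classical
solution of a two-point boundary value problem on `(0, 1)`
(`IsH10.exists_continuous_profile`, `IsH10.exists_classical_profile`). The boundary condition
`z(1) = 0` comes from the vanishing trace, and `z'(0) = 0` from the test functions that do not
vanish at `x_N = 0`. Nondegeneracy is thus the statement that `0` is not an eigenvalue of the
Sturm–Liouville problem (`isNondegenerateOneDim_of_not_isEigenvalue`).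

The linear equation `z'' = -p z` is studied through the Prüfer angle, the solution of
`θ' = sin² θ + p cos² θ`: the solution of the linear equation is a multiple of `r cos θ`, with an
explicit positive radius `r` (`IsLinearSolution.eq_polar`), and two angles, for the same or for
different `p`, are compared by means of the linear equation satisfied by their difference
(`IsPruferAngle.sub_eq_integral`). For `p = f'(U) + a` and `θ(0) = 0` the angle at `1` is a
continuous strictly increasing function of `a` with values in `(-π/2, ∞)`, it is nonpositive for
some `a`, and it is unbounded above. The eigenvalues are the parameters for which it is
`π/2 + kπ`, `k = 0, 1, 2, …` (`exists_eigenvalue_seq`).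

It remains to locate the parameter `0` (`exists_angle_of_solution`). The profile is a solution for
`p = f(U)/U > 0`; its angle `φ` is increasing, ends at `π/2 + mπ`, and hence the number of nodal
domains is `n = m + 1` (`nodalCount_lift`). Since `f(U)/U < f'(U)`, the angle `θ` of the
linearized equation ends above `π/2 + mπ`. For the upper bound, `U'` is a solution of the linearized
equation that vanishes at `0`, its angle `ψ` starts at `π/2`, above `θ`. As
`sin(ψ - φ)` is a positive multiple of `U f(U) + U'²`, the difference `ψ - φ` remains below `π`,
so that `θ(1) < ψ(1) < π/2 + nπ`. Therefore `0` lies strictly between two consecutive eigenvalues,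
the larger of which is the eigenvalue of number `n + 1`.
-/

namespace Cylinder

open Filter Topology

/-! ### Prüfer angles -/

/-- The right-hand side of the Prüfer equation `θ' = sin² θ + p cos² θ`. In the coordinates
`(z, z') = (r cos θ, -r sin θ)` this is the equation for the angle of a solution of `z'' = -p z`. -/
noncomputable def pruferField (p θ : ℝ) : ℝ := Real.sin θ ^ 2 + p * Real.cos θ ^ 2

lemma pruferField_sub (p a b : ℝ) :
    pruferField p b - pruferField p a =
      (1 - p) * Real.sinc (b - a) * Real.sin (a + b) * (b - a) := by
  have h1 : Real.sinc (b - a) * (b - a) = Real.sin (b - a) := by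
    by_cases h : b - a = 0
    · simp [h]
    · rw [Real.sinc_of_ne_zero h, div_mul_cancel₀ _ h]
  have h2 : (1 - p) * Real.sinc (b - a) * Real.sin (a + b) * (b - a) =
      (1 - p) * (Real.sinc (b - a) * (b - a)) * Real.sin (a + b) := by ring
  rw [h2, h1, Real.sin_sub, Real.sin_add, pruferField, pruferField]
  have ha := Real.sin_sq_add_cos_sq a
  have hb := Real.sin_sq_add_cos_sq b
  rw [show Real.cos b ^ 2 = 1 - Real.sin b ^ 2 by linarith,
    show Real.cos a ^ 2 = 1 - Real.sin a ^ 2 by linarith]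
  linear_combination (1 - p) * Real.sin a ^ 2 * hb - (1 - p) * Real.sin b ^ 2 * ha

lemma abs_pruferField_le (p θ : ℝ) : |pruferField p θ| ≤ 1 + |p| := by
  have h := Real.sin_sq_add_cos_sq θ
  have h1 := sq_nonneg (Real.sin θ)
  have h2 := sq_nonneg (Real.cos θ)
  calc |pruferField p θ| ≤ |Real.sin θ ^ 2| + |p| * |Real.cos θ ^ 2| := by
        rw [pruferField, ← abs_mul]; exact abs_add_le _ _
    _ ≤ 1 + |p| * 1 := by
        rw [abs_of_nonneg h1, abs_of_nonneg h2]
        gcongr <;> linarith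
    _ = 1 + |p| := by ring

/-- `θ` is a Prüfer angle on `[0, 1]` for the equation `z'' = -p z`. It is taken to be continuous
on the whole line, so that integrals of expressions in `θ` can be differentiated at `0` and `1`. -/
structure IsPruferAngle (p θ : ℝ → ℝ) : Prop where
  continuous : Continuous θ
  hasDerivAt : ∀ t ∈ Icc (0 : ℝ) 1, HasDerivAt θ (pruferField (p t) (θ t)) t

lemma continuous_pruferField {p θ : ℝ → ℝ} (hp : Continuous p) (hθ : Continuous θ) :
    Continuous fun t => pruferField (p t) (θ t) := by
  unfold pruferField; fun_prop

lemma exists_isPruferAngle {p : ℝ → ℝ} (hp : Continuous p) (θ₀ : ℝ) :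
    ∃ θ, IsPruferAngle p θ ∧ θ 0 = θ₀ := by
  obtain ⟨C, hC⟩ := (isCompact_Icc (a := (0 : ℝ)) (b := 1)).exists_bound_of_continuousOn
    hp.continuousOn
  have hC0 : 0 ≤ C := (norm_nonneg _).trans (hC 0 (by simp))
  have hPL : IsPicardLindelof (fun t x => pruferField (p t) x)
      (⟨0, by simp⟩ : Icc (0 : ℝ) 1) θ₀ ⟨1 + C, by positivity⟩ 0 ⟨1 + C, by positivity⟩
      ⟨1 + C, by positivity⟩ := by
    refine ⟨fun t ht => ?_, fun x _ => ?_, fun t ht x _ => ?_, ?_⟩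
    · apply LipschitzOnWith.of_dist_le_mul
      intro x _ y _
      rw [Real.dist_eq, Real.dist_eq, pruferField_sub, abs_mul]
      apply mul_le_mul_of_nonneg_right _ (abs_nonneg _)
      rw [abs_mul, abs_mul]
      have h1 : |1 - p t| ≤ 1 + C := by
        have := hC t ht
        rw [Real.norm_eq_abs] at this
        calc |1 - p t| ≤ |1| + |p t| := abs_sub _ _
          _ ≤ 1 + C := by rw [abs_one]; linarith
      calc |1 - p t| * |Real.sinc (x - y)| * |Real.sin (y + x)|
          ≤ (1 + C) * 1 * 1 := by
            gcongr
            · exact Real.abs_sinc_le_one _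
            · exact Real.abs_sin_le_one _
        _ = 1 + C := by ring
    · exact (continuous_pruferField hp continuous_const).continuousOn
    · have := hC t ht
      rw [Real.norm_eq_abs] at this ⊢
      exact (abs_pruferField_le _ _).trans (add_le_add_right this 1)
    · simp
  -- the field is bounded and Lipschitz in the angle, so the local solution exists on all of `[0, 1]`
  obtain ⟨α, hα0, hα⟩ := hPL.exists_eq_forall_mem_Icc_hasDerivWithinAt₀
  have hαc : ContinuousOn α (Icc 0 1) := fun t ht => (hα t ht).continuousWithinAt
  -- extension to the line: integrate the field along the constant extension `β` of `α`
  set β : ℝ → ℝ := IccExtend zero_le_one ((Icc (0 : ℝ) 1).domRestrict α) with hβ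
  have hβc : Continuous β := hαc.domRestrict.Icc_extend'
  have hβα : ∀ t ∈ Icc (0 : ℝ) 1, β t = α t := fun t ht => by
    rw [hβ, IccExtend_of_mem _ _ ht]; rfl
  have hF := continuous_pruferField hp hβc
  set θ : ℝ → ℝ := fun t => θ₀ + ∫ s in (0 : ℝ)..t, pruferField (p s) (β s) with hθ
  have hθd : ∀ t, HasDerivAt θ (pruferField (p t) (β t)) t := fun t =>
    (hF.integral_hasStrictDerivAt 0 t).hasDerivAt.const_add θ₀
  have hθα : ∀ t ∈ Icc (0 : ℝ) 1, θ t = α t := by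
    intro t ht
    have := intervalIntegral.integral_eq_sub_of_hasDerivAt_of_le (f := α)
      (f' := fun s => pruferField (p s) (β s)) ht.1
      (hαc.mono (Icc_subset_Icc_right ht.2)) (fun s hs => by
        have hs' : s ∈ Icc (0 : ℝ) 1 := ⟨hs.1.le, hs.2.le.trans ht.2⟩
        rw [hβα s hs']
        exact (hα s hs').hasDerivAt (Icc_mem_nhds hs.1 (hs.2.trans_le ht.2)))
      (hF.intervalIntegrable _ _)
    simp only [hθ, this]
    have : α 0 = θ₀ := hα0
    rw [this]; ring
  refine ⟨θ, ⟨continuous_iff_continuousAt.2 fun t => (hθd t).continuousAt, fun t ht => ?_⟩, ?_⟩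
  · rw [hθα t ht, ← hβα t ht]; exact hθd t
  · simp [hθ]

/-- Comparison of a Prüfer angle `θ₂` with a subsolution `θ₁`, the defect of which is `h`. The
difference `δ = θ₂ - θ₁` solves a linear equation `δ' = κ δ + h`, and `K` is a primitive of `κ`. -/
lemma IsPruferAngle.sub_eq_integral {p θ₁ θ₂ h : ℝ → ℝ} (hp : Continuous p)
    (hθ₁ : Continuous θ₁) (hh : Continuous h)
    (h₁ : ∀ t ∈ Icc (0 : ℝ) 1, HasDerivAt θ₁ (pruferField (p t) (θ₁ t) - h t) t)
    (h₂ : IsPruferAngle p θ₂) :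
    ∃ K : ℝ → ℝ, Continuous K ∧
      (∀ B, (∀ t ∈ Icc (0 : ℝ) 1, |1 - p t| ≤ B) → ∀ t ∈ Icc (0 : ℝ) 1, |K t| ≤ B) ∧
      (θ₂ 1 - θ₁ 1) * Real.exp (-K 1) =
        (θ₂ 0 - θ₁ 0) + ∫ t in (0 : ℝ)..1, h t * Real.exp (-K t) := by
  have hθ₂ := h₂.continuous
  set κ : ℝ → ℝ := fun t =>
    (1 - p t) * Real.sinc (θ₂ t - θ₁ t) * Real.sin (θ₁ t + θ₂ t) with hκ
  have hκc : Continuous κ := by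
    have := Real.continuous_sinc.comp (hθ₂.sub hθ₁)
    exact ((continuous_const.sub hp).mul this).mul (Real.continuous_sin.comp (hθ₁.add hθ₂))
  set K : ℝ → ℝ := fun t => ∫ s in (0 : ℝ)..t, κ s with hK
  have hKd : ∀ t, HasDerivAt K (κ t) t := fun t =>
    (hκc.integral_hasStrictDerivAt 0 t).hasDerivAt
  have hKc : Continuous K := continuous_iff_continuousAt.2 fun t => (hKd t).continuousAt
  refine ⟨K, hKc, fun B hB t ht => ?_, ?_⟩
  · have hB0 : 0 ≤ B := (abs_nonneg _).trans (hB 0 (by simp))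
    have := intervalIntegral.norm_integral_le_of_norm_le_const (a := 0) (b := t) (f := κ) (C := B)
      (fun s hs => by
        rw [uIoc_of_le ht.1] at hs
        rw [Real.norm_eq_abs, hκ, abs_mul, abs_mul]
        calc _ ≤ B * 1 * 1 := by
              gcongr
              · exact hB s ⟨hs.1.le, hs.2.trans ht.2⟩
              · exact Real.abs_sinc_le_one _
              · exact Real.abs_sin_le_one _
          _ = B := by ring)
    rw [Real.norm_eq_abs, sub_zero, abs_of_nonneg ht.1] at this
    exact this.trans (by nlinarith [ht.2])
  · have hd : ∀ t ∈ uIcc (0 : ℝ) 1, HasDerivAt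
        (fun t => (θ₂ t - θ₁ t) * Real.exp (-K t)) (h t * Real.exp (-K t)) t := by
      intro t ht
      rw [uIcc_of_le zero_le_one] at ht
      have := ((h₂.hasDerivAt t ht).sub (h₁ t ht)).mul (hKd t).neg.exp
      refine this.congr_deriv ?_
      have e := pruferField_sub (p t) (θ₁ t) (θ₂ t)
      simp only [Pi.sub_apply, Pi.neg_apply, hκ]
      linear_combination Real.exp (-K t) * e
    have := intervalIntegral.integral_eq_sub_of_hasDerivAt hd
      ((hh.mul hKc.neg.rexp).intervalIntegrable _ _)
    have hK0 : K 0 = 0 := by simp [hK]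
    rw [this]
    simp [hK0]

lemma IsPruferAngle.lt_of_subsolution {p θ₁ θ₂ h : ℝ → ℝ} (hp : Continuous p)
    (hθ₁ : Continuous θ₁) (hh : Continuous h)
    (h₁ : ∀ t ∈ Icc (0 : ℝ) 1, HasDerivAt θ₁ (pruferField (p t) (θ₁ t) - h t) t)
    (h₂ : IsPruferAngle p θ₂) (hpos : ∀ t ∈ Icc (0 : ℝ) 1, 0 ≤ h t) (h0 : θ₁ 0 ≤ θ₂ 0)
    (hs : θ₁ 0 < θ₂ 0 ∨ 0 < h 0) : θ₁ 1 < θ₂ 1 := by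
  obtain ⟨K, hKc, -, e⟩ := h₂.sub_eq_integral hp hθ₁ hh h₁
  have hint : 0 ≤ ∫ t in (0 : ℝ)..1, h t * Real.exp (-K t) :=
    intervalIntegral.integral_nonneg zero_le_one fun t ht =>
      mul_nonneg (hpos t ht) (Real.exp_pos _).le
  have : 0 < (θ₂ 1 - θ₁ 1) * Real.exp (-K 1) := by
    rw [e]
    rcases hs with hs | hs
    · linarith
    · have : 0 < ∫ t in (0 : ℝ)..1, h t * Real.exp (-K t) :=
        intervalIntegral.integral_pos zero_lt_one (hh.mul hKc.neg.rexp).continuousOn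
          (fun t ht => mul_nonneg (hpos t ⟨ht.1.le, ht.2⟩) (Real.exp_pos _).le)
          ⟨0, by simp, mul_pos hs (Real.exp_pos _)⟩
      linarith
  linarith [pos_of_mul_pos_left this (Real.exp_pos _).le]

lemma IsPruferAngle.le_of_subsolution {p θ₁ θ₂ h : ℝ → ℝ} (hp : Continuous p)
    (hθ₁ : Continuous θ₁) (hh : Continuous h)
    (h₁ : ∀ t ∈ Icc (0 : ℝ) 1, HasDerivAt θ₁ (pruferField (p t) (θ₁ t) - h t) t)
    (h₂ : IsPruferAngle p θ₂) (hpos : ∀ t ∈ Icc (0 : ℝ) 1, 0 ≤ h t) (h0 : θ₁ 0 ≤ θ₂ 0) :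
    θ₁ 1 ≤ θ₂ 1 := by
  obtain ⟨K, hKc, -, e⟩ := h₂.sub_eq_integral hp hθ₁ hh h₁
  have hint : 0 ≤ ∫ t in (0 : ℝ)..1, h t * Real.exp (-K t) :=
    intervalIntegral.integral_nonneg zero_le_one fun t ht =>
      mul_nonneg (hpos t ht) (Real.exp_pos _).le
  have : 0 ≤ (θ₂ 1 - θ₁ 1) * Real.exp (-K 1) := by rw [e]; linarith
  linarith [nonneg_of_mul_nonneg_left this (Real.exp_pos _)]

/-- A Prüfer angle for `p₁` is a subsolution for every `p₂`, with defect `(p₂ - p₁) cos² θ`. -/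
lemma IsPruferAngle.hasDerivAt_sub {p₁ θ : ℝ → ℝ} (hθ : IsPruferAngle p₁ θ) (p₂ : ℝ → ℝ) :
    ∀ t ∈ Icc (0 : ℝ) 1, HasDerivAt θ
      (pruferField (p₂ t) (θ t) - (p₂ t - p₁ t) * Real.cos (θ t) ^ 2) t := by
  intro t ht
  convert hθ.hasDerivAt t ht using 1
  simp only [pruferField]; ring

lemma IsPruferAngle.lt_of_le {p₁ p₂ θ₁ θ₂ : ℝ → ℝ} (hp₁ : Continuous p₁) (hp₂ : Continuous p₂)
    (h₁ : IsPruferAngle p₁ θ₁) (h₂ : IsPruferAngle p₂ θ₂)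
    (hp : ∀ t ∈ Icc (0 : ℝ) 1, p₁ t ≤ p₂ t) (h0 : θ₁ 0 ≤ θ₂ 0)
    (hs : θ₁ 0 < θ₂ 0 ∨ (p₁ 0 < p₂ 0 ∧ Real.cos (θ₁ 0) ≠ 0)) : θ₁ 1 < θ₂ 1 := by
  have hc := h₁.continuous
  refine h₂.lt_of_subsolution hp₂ h₁.continuous (by fun_prop) (h₁.hasDerivAt_sub p₂)
    (fun t ht => mul_nonneg (sub_nonneg.2 (hp t ht)) (sq_nonneg _)) h0 (hs.imp id fun h => ?_)
  exact mul_pos (sub_pos.2 h.1) (by have := h.2; positivity)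

/-! ### Polar representation of solutions of the linear equation -/

/-- The radius belonging to a Prüfer angle `θ`, normalized to be `1` at `0`. -/
noncomputable def pruferRadius (p θ : ℝ → ℝ) (t : ℝ) : ℝ :=
  Real.exp (∫ s in (0 : ℝ)..t, (p s - 1) * (Real.sin (θ s) * Real.cos (θ s)))

lemma pruferRadius_pos (p θ : ℝ → ℝ) (t : ℝ) : 0 < pruferRadius p θ t := Real.exp_pos _

lemma pruferRadius_zero (p θ : ℝ → ℝ) : pruferRadius p θ 0 = 1 := by simp [pruferRadius]

lemma hasDerivAt_pruferRadius {p θ : ℝ → ℝ} (hp : Continuous p) (hθ : Continuous θ) (t : ℝ) :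
    HasDerivAt (pruferRadius p θ)
      (pruferRadius p θ t * ((p t - 1) * (Real.sin (θ t) * Real.cos (θ t)))) t := by
  have hc : Continuous fun s => (p s - 1) * (Real.sin (θ s) * Real.cos (θ s)) := by fun_prop
  exact (hc.integral_hasStrictDerivAt 0 t).hasDerivAt.exp

lemma continuous_pruferRadius {p θ : ℝ → ℝ} (hp : Continuous p) (hθ : Continuous θ) :
    Continuous (pruferRadius p θ) :=
  continuous_iff_continuousAt.2 fun t => (hasDerivAt_pruferRadius hp hθ t).continuousAt

lemma IsPruferAngle.hasDerivAt_cos {p θ : ℝ → ℝ} (hp : Continuous p) (h : IsPruferAngle p θ)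
    {t : ℝ} (ht : t ∈ Icc (0 : ℝ) 1) :
    HasDerivAt (fun t => pruferRadius p θ t * Real.cos (θ t))
      (-(pruferRadius p θ t * Real.sin (θ t))) t := by
  refine ((hasDerivAt_pruferRadius hp h.continuous t).mul (h.hasDerivAt t ht).cos).congr_deriv ?_
  rw [pruferField]
  linear_combination (- pruferRadius p θ t * Real.sin (θ t)) * Real.sin_sq_add_cos_sq (θ t)

lemma IsPruferAngle.hasDerivAt_neg_sin {p θ : ℝ → ℝ} (hp : Continuous p) (h : IsPruferAngle p θ)
    {t : ℝ} (ht : t ∈ Icc (0 : ℝ) 1) :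
    HasDerivAt (fun t => -(pruferRadius p θ t * Real.sin (θ t)))
      (-(p t) * (pruferRadius p θ t * Real.cos (θ t))) t := by
  refine ((hasDerivAt_pruferRadius hp h.continuous t).mul
    (h.hasDerivAt t ht).sin).neg.congr_deriv ?_
  rw [pruferField]
  linear_combination (- p t * pruferRadius p θ t * Real.cos (θ t)) * Real.sin_sq_add_cos_sq (θ t)

lemma eq_of_hasDerivAt_zero {F : ℝ → ℝ} (hc : ContinuousOn F (Icc 0 1))
    (hd : ∀ t ∈ Ioo (0 : ℝ) 1, HasDerivAt F 0 t) {t : ℝ} (ht : t ∈ Icc (0 : ℝ) 1) :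
    F t = F 0 := by
  rcases ht.1.eq_or_lt with rfl | h0
  · rfl
  obtain ⟨c, hcm, e⟩ := exists_hasDerivAt_eq_slope F (fun _ => 0) h0
    (hc.mono (Icc_subset_Icc_right ht.2)) fun x hx => hd x ⟨hx.1, hx.2.trans_le ht.2⟩
  have : t - 0 ≠ 0 := by linarith
  field_simp at e
  linarith

/-- `y` solves `y'' = -p y` on `(0, 1)`, where `y' = w`, and both functions are continuous up to
the end points. -/
structure IsLinearSolution (p y w : ℝ → ℝ) : Prop where
  continuousOn : ContinuousOn y (Icc 0 1)
  continuousOn_deriv : ContinuousOn w (Icc 0 1)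
  hasDerivAt : ∀ t ∈ Ioo (0 : ℝ) 1, HasDerivAt y (w t) t
  hasDerivAt_deriv : ∀ t ∈ Ioo (0 : ℝ) 1, HasDerivAt w (-(p t) * y t) t

/-- Uniqueness for the initial value problem, in polar coordinates. The Wronskian of the two
solutions vanishes, so that `(y, w)` is a multiple `A r (cos θ, -sin θ)`, and then `A' = 0`. -/
lemma IsLinearSolution.eq_polar {p θ y w : ℝ → ℝ} {k : ℝ} (hy : IsLinearSolution p y w)
    (hp : Continuous p) (hθ : IsPruferAngle p θ)
    (hy0 : y 0 = k * Real.cos (θ 0)) (hw0 : w 0 = -(k * Real.sin (θ 0))) :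
    ∀ t ∈ Icc (0 : ℝ) 1, y t = k * (pruferRadius p θ t * Real.cos (θ t)) ∧
      w t = -(k * (pruferRadius p θ t * Real.sin (θ t))) := by
  set r := pruferRadius p θ with hr
  have hrc : Continuous r := continuous_pruferRadius hp hθ.continuous
  have hrp : ∀ t, 0 < r t := pruferRadius_pos p θ
  have hθc := hθ.continuous
  have hyc := hy.continuousOn
  have hwc := hy.continuousOn_deriv
  have hW : ∀ t ∈ Icc (0 : ℝ) 1, y t * Real.sin (θ t) + w t * Real.cos (θ t) = 0 := by
    intro t ht
    have e := eq_of_hasDerivAt_zero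
      (F := fun t => y t * -(r t * Real.sin (θ t)) - w t * (r t * Real.cos (θ t)))
      (by fun_prop) (fun s hs => by
        have hs' := Ioo_subset_Icc_self hs
        refine (((hy.hasDerivAt s hs).mul (hθ.hasDerivAt_neg_sin hp hs')).sub
          ((hy.hasDerivAt_deriv s hs).mul (hθ.hasDerivAt_cos hp hs'))).congr_deriv ?_
        ring) ht
    simp only [hy0, hw0] at e
    have : r t * (y t * Real.sin (θ t) + w t * Real.cos (θ t)) = 0 := by linear_combination -e
    exact (mul_eq_zero.1 this).resolve_left (hrp t).ne'
  intro t ht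
  have e := eq_of_hasDerivAt_zero
    (F := fun t => (y t * Real.cos (θ t) - w t * Real.sin (θ t)) / r t)
    (ContinuousOn.div (by fun_prop) (by fun_prop) fun t _ => (hrp t).ne') (fun s hs => by
      have hs' := Ioo_subset_Icc_self hs
      have hθs := hθ.hasDerivAt s hs'
      refine ((((hy.hasDerivAt s hs).mul hθs.cos).sub
        ((hy.hasDerivAt_deriv s hs).mul hθs.sin)).div
          (hasDerivAt_pruferRadius hp hθc s) (hrp s).ne').congr_deriv ?_
      have hrs := (hrp s).ne'
      rw [← hr, div_eq_zero_iff]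
      left
      have hWs := hW s hs'
      simp only [pruferField, Pi.sub_apply, Pi.mul_apply]
      have h1 := Real.sin_sq_add_cos_sq (θ s)
      have hy' : y s = (y s * Real.cos (θ s) - w s * Real.sin (θ s)) * Real.cos (θ s) := by
        linear_combination (Real.sin (θ s)) * hWs - y s * h1
      have hw' : w s = -((y s * Real.cos (θ s) - w s * Real.sin (θ s)) * Real.sin (θ s)) := by
        linear_combination (Real.cos (θ s)) * hWs - w s * h1
      set c := y s * Real.cos (θ s) - w s * Real.sin (θ s)
      rw [hy', hw']
      ring) ht
  have hr0 : r 0 = 1 := pruferRadius_zero p θ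
  simp only [hr0, hy0, hw0, div_one] at e
  have hA : y t * Real.cos (θ t) - w t * Real.sin (θ t) = k * r t := by
    rw [div_eq_iff (hrp t).ne'] at e
    linear_combination e + k * r t * Real.sin_sq_add_cos_sq (θ 0)
  have h1 := Real.sin_sq_add_cos_sq (θ t)
  have hWt := hW t ht
  constructor
  · linear_combination (Real.sin (θ t)) * hWt - y t * h1 + Real.cos (θ t) * hA
  · linear_combination (Real.cos (θ t)) * hWt - w t * h1 - Real.sin (θ t) * hA

/-! ### The angle at the right end point as a function of the spectral parameter -/

lemma isEigenvalue_iff_cos_eq_zero {f U q θ : ℝ → ℝ} {a : ℝ} (hq : Continuous q)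
    (hqU : ∀ t ∈ Ioo (0 : ℝ) 1, deriv f (U t) = q t)
    (hθ : IsPruferAngle (fun t => q t + a) θ) (h0 : θ 0 = 0) :
    IsEigenvalue f U a ↔ Real.cos (θ 1) = 0 := by
  have hp : Continuous fun t => q t + a := by fun_prop
  have hθc := hθ.continuous
  constructor
  · rintro ⟨z, w, hz, hw, hzd, hwd, hw0, hz1, t, ht, hzt⟩
    have hlin : IsLinearSolution (fun t => q t + a) z w := by
      refine ⟨hz, hw, hzd, fun t ht => ?_⟩
      obtain ⟨w', hw', e⟩ := hwd t ht
      refine hw'.congr_deriv ?_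
      rw [hqU t ht] at e
      linear_combination -e
    have key := hlin.eq_polar (k := z 0) hp hθ (by simp [h0]) (by simp [h0, hw0])
    have hk : z 0 ≠ 0 := by
      intro hk
      exact hzt (by rw [(key t (Ioo_subset_Icc_self ht)).1, hk, zero_mul])
    have h1 := (key 1 (by simp)).1
    rw [hz1] at h1
    simpa [hk, (pruferRadius_pos _ θ 1).ne'] using h1.symm
  · intro hcos
    have hr := continuous_pruferRadius hp hθc
    refine ⟨fun t => pruferRadius (fun t => q t + a) θ t * Real.cos (θ t),
      fun t => -(pruferRadius (fun t => q t + a) θ t * Real.sin (θ t)),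
      by fun_prop, by fun_prop,
      fun t ht => hθ.hasDerivAt_cos hp (Ioo_subset_Icc_self ht),
      fun t ht => ⟨_, hθ.hasDerivAt_neg_sin hp (Ioo_subset_Icc_self ht), ?_⟩,
      by simp [h0], by simp [hcos], ?_⟩
    · rw [hqU t ht]; ring
    · -- the eigenfunction is `1` at `0`, hence nonzero at some interior point nearby
      have hc : ContinuousAt (fun t => Real.cos (θ t)) 0 := by fun_prop
      have hev : ∀ᶠ t in 𝓝 (0 : ℝ), Real.cos (θ t) ≠ 0 := hc.eventually_ne (by simp [h0])
      obtain ⟨t, ht, ht'⟩ := ((hev.filter_mono nhdsWithin_le_nhds).and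
        (Ioo_mem_nhdsGT (zero_lt_one (α := ℝ)))).exists
      exact ⟨t, ht', mul_ne_zero (pruferRadius_pos _ θ t).ne' ht⟩

/-- The time a Prüfer angle needs to reach the angle `C` tends to zero as the coefficient
tends to infinity. -/
lemma tendsto_integral_inv_pruferField (C : ℝ) :
    Tendsto (fun p : ℝ => ∫ x in (0 : ℝ)..C, (pruferField p x)⁻¹) atTop (𝓝 0) := by
  have key : ∀ p : ℝ, 1 ≤ p → ∀ x, 1 ≤ pruferField p x := by
    intro p hp x
    rw [pruferField]
    nlinarith [Real.sin_sq_add_cos_sq x, sq_nonneg (Real.cos x)]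
  have hne : ∀ᵐ x : ℝ, Real.cos x ≠ 0 := by
    have : {x : ℝ | Real.cos x = 0} ⊆ range fun k : ℤ => (2 * k + 1) * Real.pi / 2 := by
      intro x hx
      obtain ⟨k, hk⟩ := Real.cos_eq_zero_iff.1 hx
      exact ⟨k, hk.symm⟩
    rw [ae_iff]
    simp only [not_not]
    exact ((countable_range _).mono this).measure_zero _
  have := intervalIntegral.tendsto_integral_filter_of_dominated_convergence
    (μ := volume) (a := 0) (b := C) (l := atTop) (f := fun _ => (0 : ℝ))
    (F := fun p x => (pruferField p x)⁻¹) (fun _ => 1)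
    (Eventually.of_forall fun p => by
      apply Measurable.aestronglyMeasurable
      unfold pruferField
      fun_prop)
    (by
      filter_upwards [eventually_ge_atTop 1] with p hp
      refine Eventually.of_forall fun x _ => ?_
      have := key p hp x
      rw [Real.norm_eq_abs, abs_of_pos (by positivity)]
      exact inv_le_one_of_one_le₀ this)
    intervalIntegrable_const
    (by
      filter_upwards [hne] with x hx _
      apply Tendsto.inv_tendsto_atTop
      unfold pruferField
      exact tendsto_atTop_add_const_left _ _ (tendsto_id.atTop_mul_const (by positivity)))
  simpa using this

lemma exists_le_of_isPruferAngle {q : ℝ → ℝ} (hq : Continuous q) (C : ℝ) {Θ : ℝ → ℝ → ℝ}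
    (hΘ : ∀ a, IsPruferAngle (fun t => q t + a) (Θ a)) (h0 : ∀ a, Θ a 0 = 0) :
    ∃ a, C ≤ Θ a 1 := by
  obtain ⟨M, hM⟩ := (isCompact_Icc (a := (0 : ℝ)) (b := 1)).exists_bound_of_continuousOn
    hq.continuousOn
  obtain ⟨p, hp, hp1⟩ := (((tendsto_integral_inv_pruferField C).eventually
    (gt_mem_nhds zero_lt_one)).and (eventually_ge_atTop 1)).exists
  refine ⟨p + M, ?_⟩
  by_contra! hlt
  have hpos : ∀ x, 0 < pruferField p x := by
    intro x
    rw [pruferField]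
    nlinarith [Real.sin_sq_add_cos_sq x, sq_nonneg (Real.cos x)]
  have hc : Continuous fun x => (pruferField p x)⁻¹ :=
    (continuous_pruferField continuous_const continuous_id).inv₀ fun x => (hpos x).ne'
  have hd := fun x => (hc.integral_hasStrictDerivAt 0 x).hasDerivAt
  set Φ : ℝ → ℝ := fun y => ∫ x in (0 : ℝ)..y, (pruferField p x)⁻¹ with hΦ
  have hmono : Monotone Φ := monotone_of_hasDerivAt_nonneg hd fun x => (inv_pos.2 (hpos x)).le
  -- `Φ (Θ t)` grows at least with speed `1`, but `Φ C < 1`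
  have hcomp : ∀ t ∈ Icc (0 : ℝ) 1, HasDerivAt (fun t => Φ (Θ (p + M) t))
      ((pruferField p (Θ (p + M) t))⁻¹ *
        pruferField (q t + (p + M)) (Θ (p + M) t)) t := fun t ht =>
    (hd _).comp t ((hΘ (p + M)).hasDerivAt t ht)
  have hge : ∀ t ∈ Icc (0 : ℝ) 1, 1 ≤ (pruferField p (Θ (p + M) t))⁻¹ *
      pruferField (q t + (p + M)) (Θ (p + M) t) := by
    intro t ht
    rw [inv_mul_eq_div, one_le_div (hpos _)]
    have := neg_le_of_abs_le (hM t ht)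
    unfold pruferField
    nlinarith [sq_nonneg (Real.cos (Θ (p + M) t))]
  obtain ⟨c, hcm, e⟩ := exists_hasDerivAt_eq_slope _ _ (zero_lt_one (α := ℝ))
    (fun t ht => (hcomp t ht).continuousAt.continuousWithinAt)
    fun t ht => hcomp t (Ioo_subset_Icc_self ht)
  have h1 := hge c (Ioo_subset_Icc_self hcm)
  rw [e] at h1
  have hΦ0 : Φ 0 = 0 := by simp [hΦ]
  rw [h0, hΦ0] at h1
  have := hmono hlt.le
  linarith

lemma continuous_endAngle {q : ℝ → ℝ} (hq : Continuous q) {Θ : ℝ → ℝ → ℝ}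
    (hΘ : ∀ a, IsPruferAngle (fun t => q t + a) (Θ a)) (h0 : ∀ a, Θ a 0 = 0) :
    Continuous fun a => Θ a 1 := by
  rw [continuous_iff_continuousAt]
  intro b
  obtain ⟨B, hB⟩ := (isCompact_Icc (a := (0 : ℝ)) (b := 1)).exists_bound_of_continuousOn
    (f := fun t => 1 - (q t + b)) (by fun_prop)
  have key : ∀ a, |Θ a 1 - Θ b 1| ≤ |b - a| * Real.exp B * Real.exp B := by
    intro a
    have hc := (hΘ a).continuous
    obtain ⟨K, hKc, hK, e⟩ := (hΘ b).sub_eq_integral (by fun_prop) hc (by fun_prop)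
      ((hΘ a).hasDerivAt_sub fun t => q t + b)
    have hK' := hK B hB
    rw [h0, h0, sub_zero, zero_add] at e
    have hbound : |(Θ b 1 - Θ a 1) * Real.exp (-K 1)| ≤ |b - a| * Real.exp B := by
      rw [e]
      have := intervalIntegral.norm_integral_le_of_norm_le_const (a := 0) (b := 1)
        (C := |b - a| * Real.exp B)
        (f := fun t => (q t + b - (q t + a)) * Real.cos (Θ a t) ^ 2 * Real.exp (-K t))
        (fun t ht => by
          rw [uIoc_of_le zero_le_one] at ht
          have ht' : t ∈ Icc (0 : ℝ) 1 := ⟨ht.1.le, ht.2⟩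
          rw [Real.norm_eq_abs, abs_mul, abs_mul, Real.abs_exp, abs_pow, sq_abs]
          have h1 : Real.cos (Θ a t) ^ 2 ≤ 1 := Real.cos_sq_le_one _
          have h2 : Real.exp (-K t) ≤ Real.exp B :=
            Real.exp_le_exp.2 (by linarith [neg_abs_le (K t), hK' t ht'])
          rw [show q t + b - (q t + a) = b - a by ring]
          calc _ ≤ |b - a| * 1 * Real.exp B := by gcongr
            _ = _ := by ring)
      simpa using this
    have h3 : 1 ≤ Real.exp (-K 1) * Real.exp B := by
      rw [← Real.exp_add]
      exact Real.one_le_exp (by linarith [le_abs_self (K 1), hK' 1 (by simp)])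
    rw [abs_mul, Real.abs_exp] at hbound
    rw [abs_sub_comm]
    calc |Θ b 1 - Θ a 1| = |Θ b 1 - Θ a 1| * 1 := by ring
      _ ≤ |Θ b 1 - Θ a 1| * (Real.exp (-K 1) * Real.exp B) := by gcongr
      _ = |Θ b 1 - Θ a 1| * Real.exp (-K 1) * Real.exp B := by ring
      _ ≤ |b - a| * Real.exp B * Real.exp B := by gcongr
  refine tendsto_iff_dist_tendsto_zero.2 (squeeze_zero (fun _ => dist_nonneg)
    (fun a => (Real.dist_eq _ _).trans_le (key a)) ?_)
  have : Continuous fun a => |b - a| * Real.exp B * Real.exp B := by fun_prop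
  simpa using this.tendsto b

lemma strictMono_endAngle {q : ℝ → ℝ} (hq : Continuous q) {Θ : ℝ → ℝ → ℝ}
    (hΘ : ∀ a, IsPruferAngle (fun t => q t + a) (Θ a)) (h0 : ∀ a, Θ a 0 = 0) :
    StrictMono fun a => Θ a 1 := fun a b hab =>
  (hΘ a).lt_of_le (by fun_prop) (by fun_prop) (hΘ b) (fun t _ => by linarith)
    (by rw [h0, h0]) (.inr ⟨by linarith, by simp [h0]⟩)

/-- The level `-π/2` is crossed by a Prüfer angle in the increasing direction only. -/
lemma IsPruferAngle.neg_pi_div_two_lt {p θ : ℝ → ℝ} (hp : Continuous p) (h : IsPruferAngle p θ)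
    (h0 : θ 0 = 0) : -(Real.pi / 2) < θ 1 := by
  refine h.lt_of_subsolution (θ₁ := fun _ => -(Real.pi / 2)) (h := fun _ => 1) hp
    continuous_const continuous_const (fun t _ => ?_) (fun _ _ => zero_le_one) ?_
    (.inr zero_lt_one)
  · simpa [pruferField] using hasDerivAt_const t (-(Real.pi / 2))
  · rw [h0]; linarith [Real.pi_pos]

lemma exists_endAngle_nonpos {q : ℝ → ℝ} (hq : Continuous q) {Θ : ℝ → ℝ → ℝ}
    (hΘ : ∀ a, IsPruferAngle (fun t => q t + a) (Θ a)) (h0 : ∀ a, Θ a 0 = 0) :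
    ∃ a, Θ a 1 ≤ 0 := by
  obtain ⟨M, hM⟩ := (isCompact_Icc (a := (0 : ℝ)) (b := 1)).exists_bound_of_continuousOn
    hq.continuousOn
  have hc := (hΘ (-M)).continuous
  have hzero : IsPruferAngle (fun _ => 0) (fun _ => 0) :=
    ⟨continuous_const, fun t _ => by simpa [pruferField] using hasDerivAt_const t (0 : ℝ)⟩
  refine ⟨-M, hzero.le_of_subsolution continuous_const hc (by fun_prop)
    ((hΘ (-M)).hasDerivAt_sub fun _ => 0) (fun t ht => ?_) (h0 _).le⟩
  have := le_of_abs_le (hM t ht)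
  exact mul_nonneg (by linarith) (sq_nonneg _)

/-- The eigenvalues form a strictly increasing sequence, the `k`-th of which is the parameter for
which the angle at `1` is `π/2 + k π`. -/
lemma exists_eigenvalue_seq {f U q : ℝ → ℝ} (hq : Continuous q)
    (hqU : ∀ t ∈ Ioo (0 : ℝ) 1, deriv f (U t) = q t) {Θ : ℝ → ℝ → ℝ}
    (hΘ : ∀ a, IsPruferAngle (fun t => q t + a) (Θ a)) (h0 : ∀ a, Θ a 0 = 0) :
    ∃ α : ℕ → ℝ, StrictMono α ∧ range α = {a | IsEigenvalue f U a} ∧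
      ∀ k, Θ (α k) 1 = Real.pi / 2 + k * Real.pi := by
  have hmono := strictMono_endAngle hq hΘ h0
  have hex : ∀ k : ℕ, ∃ a, Θ a 1 = Real.pi / 2 + k * Real.pi := by
    intro k
    obtain ⟨a, ha⟩ := exists_endAngle_nonpos hq hΘ h0
    exact mem_range_of_exists_le_of_exists_ge (continuous_endAngle hq hΘ h0)
      ⟨a, ha.trans (by positivity)⟩ (exists_le_of_isPruferAngle hq _ hΘ h0)
  choose α hα using hex
  refine ⟨α, fun i j hij => ?_, ?_, hα⟩
  · rw [← hmono.lt_iff_lt]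
    simp only [hα]
    have : (i : ℝ) < j := by exact_mod_cast hij
    nlinarith [Real.pi_pos]
  · ext a
    rw [mem_ofPred_eq, isEigenvalue_iff_cos_eq_zero hq hqU (hΘ a) (h0 a)]
    constructor
    · rintro ⟨k, rfl⟩
      rw [hα, Real.cos_eq_zero_iff]
      exact ⟨k, by push_cast; ring⟩
    · intro hcos
      obtain ⟨j, hj⟩ := Real.cos_eq_zero_iff.1 hcos
      have hlow := (hΘ a).neg_pi_div_two_lt (by fun_prop) (h0 a)
      have hj0 : 0 ≤ j := by
        by_contra! hneg
        have : (j : ℝ) ≤ -1 := by exact_mod_cast Int.le_sub_one_of_lt hneg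
        nlinarith [Real.pi_pos]
      lift j to ℕ using hj0
      refine ⟨j, hmono.injective ?_⟩
      simp only [hα, hj]
      push_cast; ring

/-! ### Counting the nodal domains -/

variable {d : ℕ}

lemma card_connectedComponents_eq_encard_range {X Y : Type*} [TopologicalSpace X]
    [TopologicalSpace Y] [TotallyDisconnectedSpace Y] {κ : X → Y} (hκ : Continuous κ)
    (hfib : ∀ y, IsPreconnected (κ ⁻¹' {y})) :
    ENat.card (ConnectedComponents X) = (range κ).encard := by
  have hinj : Function.Injective hκ.connectedComponentsLift := by
    intro a b
    obtain ⟨x, rfl⟩ := ConnectedComponents.surjective_coe a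
    obtain ⟨y, rfl⟩ := ConnectedComponents.surjective_coe b
    rw [hκ.connectedComponentsLift_apply_coe, hκ.connectedComponentsLift_apply_coe]
    intro h
    exact ConnectedComponents.coe_eq_coe'.2
      ((hfib (κ y)).subset_connectedComponent rfl h)
  have hrange : range hκ.connectedComponentsLift = range κ := by
    rw [← ConnectedComponents.surjective_coe.range_comp, hκ.connectedComponentsLift_comp_coe]
  rw [← hrange, ← ENat.card_coe_set_eq]
  exact ENat.card_congr (Equiv.ofInjective _ hinj)

/-- If the zeros of `U` in `(0, 1)` are the points where an increasing angle `φ` runs through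
`π/2 + ℤπ`, then `⌊φ/π + 1/2⌋` numbers the nodal domains of `(x', x_N) ↦ U(x_N)`. -/
lemma nodalCount_lift {ω : Set (EuclideanSpace ℝ (Fin d))} (hω : IsConnected ω)
    {U φ : ℝ → ℝ} {m : ℕ} (hφ : ContinuousOn φ (Icc 0 1)) (hmono : StrictMonoOn φ (Icc 0 1))
    (h0 : φ 0 = 0) (h1 : φ 1 = Real.pi / 2 + m * Real.pi)
    (hU : ∀ t ∈ Ioo (0 : ℝ) 1, U t ≠ 0 ↔ Real.cos (φ t) ≠ 0) :
    nodalCount ω (lift d U) = (m + 1 : ℕ) := by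
  have hπ := Real.pi_pos
  set S := {x : Pt d // x ∈ cylinder ω ∧ lift d U x ≠ 0}
  set χ : ℝ → ℝ := fun t => φ t / Real.pi + 1 / 2 with hχ
  have hχc : ContinuousOn χ (Ioo 0 1) := by
    have := hφ.mono Ioo_subset_Icc_self
    fun_prop
  have hχmono : StrictMonoOn χ (Icc 0 1) := fun s hs t ht hst => by
    have := hmono hs ht hst
    simp only [hχ]
    gcongr
  have hsndIoo : ∀ x : S, x.1.2 ∈ Ioo (0 : ℝ) 1 := fun x => x.2.1.2
  -- `U` vanishes exactly where `χ` is an integer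
  have hnotint : ∀ t ∈ Ioo (0 : ℝ) 1, U t ≠ 0 ↔ (⌊χ t⌋ : ℝ) < χ t := by
    intro t ht
    rw [hU t ht, lt_iff_le_and_ne, and_iff_right (Int.floor_le _), not_iff_not,
      Real.cos_eq_zero_iff]
    constructor
    · rintro ⟨k, hk⟩
      have : χ t = ((k + 1 : ℤ) : ℝ) := by
        simp only [hχ, hk]; push_cast; field_simp; ring
      rw [this, Int.floor_intCast]
    · intro h
      refine ⟨⌊χ t⌋ - 1, ?_⟩
      have h' : φ t = (χ t - 1 / 2) * Real.pi := by simp only [hχ]; field_simp; ring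
      rw [h', ← h]
      simp only [Int.floor_intCast]
      push_cast; ring
  set κ : S → ℤ := fun x => ⌊χ x.1.2⌋ with hκ
  have hκc : Continuous κ := by
    rw [continuous_iff_continuousAt]
    intro x
    have hx := hsndIoo x
    have hlt : (⌊χ x.1.2⌋ : ℝ) < χ x.1.2 := (hnotint _ hx).1 x.2.2
    have hcomp : ContinuousAt (fun y : S => χ y.1.2) x :=
      ContinuousAt.comp (g := χ) (f := fun y : S => y.1.2)
        (hχc.continuousAt (isOpen_Ioo.mem_nhds hx))
        (continuous_snd.comp continuous_subtype_val).continuousAt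
    have : ∀ᶠ y in 𝓝 x, κ y = κ x := by
      filter_upwards [hcomp.eventually (Ioo_mem_nhds hlt (Int.lt_floor_add_one (χ x.1.2)))]
        with y hy
      exact Int.floor_eq_iff.2 ⟨hy.1.le, hy.2⟩
    exact (continuousAt_const (y := κ x)).congr (this.mono fun y hy => hy.symm)
  have hfib : ∀ j : ℤ, IsPreconnected (κ ⁻¹' {j}) := by
    intro j
    rw [← (show Topology.IsInducing (Subtype.val : S → Pt d) from
      Topology.IsInducing.subtypeVal).isPreconnected_image]
    have himg : Subtype.val '' (κ ⁻¹' {j}) =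
        ω ×ˢ {t | t ∈ Ioo (0 : ℝ) 1 ∧ χ t ∈ Ioo (j : ℝ) (j + 1)} := by
      ext x
      constructor
      · rintro ⟨y, hy, rfl⟩
        refine ⟨y.2.1.1, y.2.1.2, ?_⟩
        have hlt := (hnotint _ (hsndIoo y)).1 y.2.2
        have hy' : ⌊χ y.1.2⌋ = j := hy
        rw [hy'] at hlt
        exact ⟨hlt, by rw [← hy']; exact Int.lt_floor_add_one _⟩
      · rintro ⟨hx1, hx2, hx3⟩
        have hfl : ⌊χ x.2⌋ = j := Int.floor_eq_iff.2 ⟨hx3.1.le, hx3.2⟩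
        refine ⟨⟨x, ⟨hx1, hx2⟩, (hnotint _ hx2).2 ?_⟩, hfl, rfl⟩
        rw [hfl]; exact hx3.1
    rw [himg]
    refine hω.isPreconnected.prod (OrdConnected.isPreconnected ⟨fun s hs t ht r hr => ?_⟩)
    have hr' : r ∈ Ioo (0 : ℝ) 1 := ⟨hs.1.1.trans_le hr.1, hr.2.trans_lt ht.1.2⟩
    have hm := hχmono.monotoneOn
    exact ⟨hr', hs.2.1.trans_le (hm (Ioo_subset_Icc_self hs.1) (Ioo_subset_Icc_self hr') hr.1),
      (hm (Ioo_subset_Icc_self hr') (Ioo_subset_Icc_self ht.1) hr.2).trans_lt ht.2.2⟩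
  have hrange : range κ = (Finset.Icc (0 : ℤ) m : Finset ℤ) := by
    ext j
    rw [Finset.coe_Icc]
    constructor
    · rintro ⟨x, rfl⟩
      have hx := hsndIoo x
      have hlo := hmono (by simp) (Ioo_subset_Icc_self hx) hx.1
      have hhi := hmono (Ioo_subset_Icc_self hx) (by simp) hx.2
      rw [h0] at hlo
      rw [h1] at hhi
      have hhi' : φ x.1.2 / Real.pi < 1 / 2 + m := by
        rw [div_lt_iff₀ hπ]; linarith
      refine ⟨Int.floor_nonneg.2 (by simp only [hχ]; positivity), ?_⟩
      rw [← Int.lt_add_one_iff, Int.floor_lt]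
      simp only [hχ]; push_cast; linarith
    · rintro ⟨hj0, hjm⟩
      have hj0' : (0 : ℝ) ≤ j := by exact_mod_cast hj0
      have hjm' : (j : ℝ) ≤ m := by exact_mod_cast hjm
      -- the point where `φ = jπ + π/4` lies in the domain with number `j`
      obtain ⟨t, ht, e⟩ := intermediate_value_Ioo zero_le_one hφ
        (show j * Real.pi + Real.pi / 4 ∈ Ioo (φ 0) (φ 1) by
          rw [h0, h1]; constructor <;> nlinarith)
      obtain ⟨y, hy⟩ := hω.nonempty
      have hχt : χ t = j + 3 / 4 := by simp only [hχ, e]; field_simp; ring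
      have hfl : ⌊χ t⌋ = j := Int.floor_eq_iff.2 ⟨by linarith, by linarith⟩
      exact ⟨⟨(y, t), ⟨hy, ht⟩, (hnotint t ht).2 (by rw [hfl]; linarith)⟩, hfl⟩
  rw [nodalCount, card_connectedComponents_eq_encard_range hκc hfib, hrange,
    encard_coe_eq_coe_finsetCard, Int.card_Icc]
  norm_num

/-! ### The one-dimensional problem -/

/-- Localization of the parameter `0` between two consecutive eigenvalues. The solution is
`z = z(0) r cos φ`, where `φ` increases from `0` to `π/2 + m π`. On the one hand the coefficient
`f(z)/z` of the equation satisfied by `z` is below `f'(z)`; on the other hand `z'` is a solution of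
the linearized equation, and its angle `ψ` stays within a distance `π` of `φ`. -/
lemma exists_angle_of_solution {f : ℝ → ℝ} (hf : ContDiff ℝ 1 f)
    (hf1 : ∀ s : ℝ, s ≠ 0 → f s / s < deriv f s) (hf3 : ∀ s : ℝ, s ≠ 0 → 0 < s * f s)
    {z w : ℝ → ℝ} (hz : Continuous z) (hw : Continuous w)
    (hzd : ∀ t ∈ Ioo (0 : ℝ) 1, HasDerivAt z (w t) t)
    (hwd : ∀ t ∈ Ioo (0 : ℝ) 1, HasDerivAt w (-f (z t)) t) (hw0 : w 0 = 0) (hz1 : z 1 = 0)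
    (hne : ∃ t ∈ Ioo (0 : ℝ) 1, z t ≠ 0) {θ : ℝ → ℝ}
    (hθ : IsPruferAngle (fun t => deriv f (z t)) θ) (hθ0 : θ 0 = 0) :
    ∃ (m : ℕ) (φ : ℝ → ℝ), Continuous φ ∧ StrictMonoOn φ (Icc 0 1) ∧ φ 0 = 0 ∧
      φ 1 = Real.pi / 2 + m * Real.pi ∧
      (∀ t ∈ Icc (0 : ℝ) 1, z t ≠ 0 ↔ Real.cos (φ t) ≠ 0) ∧
      Real.pi / 2 + m * Real.pi < θ 1 ∧ θ 1 < Real.pi / 2 + (m + 1) * Real.pi := by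
  have hπ := Real.pi_pos
  have hfd : Differentiable ℝ f := hf.differentiable one_ne_zero
  -- `f` has the sign of its argument, hence vanishes at `0` by continuity
  have hf0 : f 0 = 0 := by
    by_contra hne0
    rcases lt_or_gt_of_ne hne0 with h | h
    · have h2 : ∀ᶠ s in 𝓝[>] (0 : ℝ), f s < 0 :=
        (hf.continuous.continuousAt.eventually (gt_mem_nhds h)).filter_mono nhdsWithin_le_nhds
      obtain ⟨s, hs, hs0⟩ := (h2.and self_mem_nhdsWithin).exists
      have hs0' : 0 < s := hs0
      nlinarith [hf3 s hs0'.ne']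
    · have h2 : ∀ᶠ s in 𝓝[<] (0 : ℝ), 0 < f s :=
        (hf.continuous.continuousAt.eventually (lt_mem_nhds h)).filter_mono nhdsWithin_le_nhds
      obtain ⟨s, hs, hs0⟩ := (h2.and self_mem_nhdsWithin).exists
      have hs0' : s < 0 := hs0
      nlinarith [hf3 s hs0'.ne]
  set q : ℝ → ℝ := fun t => deriv f (z t) with hq
  have hqc : Continuous q := (hf.continuous_deriv le_rfl).comp hz
  -- `g s = f s / s`, extended continuously by `f'(0)`
  set g : ℝ → ℝ := dslope f 0 with hg
  have hgc : Continuous g := by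
    rw [continuous_iff_continuousAt]
    intro s
    by_cases hs : s = 0
    · rw [hs]; exact continuousAt_dslope_same.2 (hfd 0)
    · exact (continuousAt_dslope_of_ne hs).2 hf.continuous.continuousAt
  have hgs : ∀ s, s ≠ 0 → g s = f s / s := by
    intro s hs
    rw [hg, dslope_of_ne _ hs, slope_def_field, hf0, sub_zero, sub_zero]
  have hgmul : ∀ s, f s = g s * s := by
    intro s
    by_cases hs : s = 0
    · rw [hs, hf0, mul_zero]
    · rw [hgs s hs, div_mul_cancel₀ _ hs]
  have hgpos : ∀ s, s ≠ 0 → 0 < g s := by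
    intro s hs
    have h1 := hf3 s hs
    rw [hgmul] at h1
    have : 0 < s ^ 2 := by positivity
    nlinarith
  have hglt : ∀ s, s ≠ 0 → g s < deriv f s := fun s hs => by rw [hgs s hs]; exact hf1 s hs
  have hgle : ∀ s, g s ≤ deriv f s := by
    intro s
    by_cases hs : s = 0
    · rw [hs, hg, dslope_same]
    · exact (hglt s hs).le
  set c : ℝ → ℝ := fun t => g (z t) with hc
  have hcc : Continuous c := hgc.comp hz
  obtain ⟨φ, hφ, hφ0⟩ := exists_isPruferAngle hcc 0
  have hlin : IsLinearSolution c z w := ⟨hz.continuousOn, hw.continuousOn, hzd, fun t ht =>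
    (hwd t ht).congr_deriv (by rw [hgmul]; ring)⟩
  have hpol := hlin.eq_polar (k := z 0) hcc hφ (by simp [hφ0]) (by simp [hφ0, hw0])
  have hr := pruferRadius_pos c φ
  set r := pruferRadius c φ
  have hk : z 0 ≠ 0 := by
    intro hk
    obtain ⟨t, ht, hzt⟩ := hne
    exact hzt (by rw [(hpol t (Ioo_subset_Icc_self ht)).1, hk, zero_mul])
  have hziff : ∀ t ∈ Icc (0 : ℝ) 1, z t ≠ 0 ↔ Real.cos (φ t) ≠ 0 := by
    intro t ht
    rw [(hpol t ht).1]
    simp [hk, (hr t).ne']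
  -- where `cos φ = 0` the derivative of `φ` is `1`; elsewhere `z ≠ 0` and `f(z)/z > 0`
  have hmono : StrictMonoOn φ (Icc 0 1) := by
    refine strictMonoOn_of_deriv_pos (convex_Icc 0 1) hφ.continuous.continuousOn fun t ht => ?_
    rw [interior_Icc] at ht
    have ht' := Ioo_subset_Icc_self ht
    rw [(hφ.hasDerivAt t ht').deriv, pruferField]
    by_cases hcos : Real.cos (φ t) = 0
    · have := Real.sin_sq_add_cos_sq (φ t)
      rw [hcos] at this ⊢
      linarith
    · have := hgpos _ ((hziff t ht').2 hcos)
      positivity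
  have hφ1pos : 0 < φ 1 := by
    have := hmono (by simp) (by simp) (zero_lt_one (α := ℝ))
    rwa [hφ0] at this
  have hcos1 : Real.cos (φ 1) = 0 := by
    by_contra h
    exact (hziff 1 (by simp)).2 h hz1
  obtain ⟨j, hj⟩ := Real.cos_eq_zero_iff.1 hcos1
  have hj0 : 0 ≤ j := by
    by_contra! hneg
    have : (j : ℝ) ≤ -1 := by exact_mod_cast Int.le_sub_one_of_lt hneg
    nlinarith
  lift j to ℕ using hj0
  have hφ1 : φ 1 = Real.pi / 2 + j * Real.pi := by rw [hj]; push_cast; ring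
  refine ⟨j, φ, hφ.continuous, hmono, hφ0, hφ1, hziff, ?_, ?_⟩
  · rw [← hφ1]
    exact hφ.lt_of_le hcc hqc hθ (fun t _ => hgle _) (by rw [hφ0, hθ0])
      (.inr ⟨hglt _ hk, by simp [hφ0]⟩)
  · obtain ⟨ψ, hψ, hψ0⟩ := exists_isPruferAngle hqc (Real.pi / 2)
    have hlt : θ 1 < ψ 1 := hθ.lt_of_le hqc hqc hψ (fun t _ => le_rfl)
      (by rw [hθ0, hψ0]; positivity) (.inl (by rw [hθ0, hψ0]; positivity))
    have hlin' : IsLinearSolution q w (fun t => -f (z t)) :=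
      ⟨hw.continuousOn, (hf.continuous.comp hz).neg.continuousOn, hwd, fun t ht =>
        ((hfd (z t)).hasDerivAt.comp t (hzd t ht)).neg.congr_deriv (by simp [hq])⟩
    have hpol' := hlin'.eq_polar (k := f (z 0)) hqc hψ (by simp [hψ0, hw0]) (by simp [hψ0])
    have hρ := pruferRadius_pos q ψ
    set ρ := pruferRadius q ψ
    -- `sin (ψ - φ)` is a nonzero multiple of `z f(z) + z'²`
    have hsin : ∀ t ∈ Icc (0 : ℝ) 1, Real.sin (ψ t - φ t) ≠ 0 := by
      intro t ht hs
      obtain ⟨e1, e2⟩ := hpol t ht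
      obtain ⟨e3, e4⟩ := hpol' t ht
      have hprod : z t * f (z t) + w t ^ 2 = 0 := by
        have : z t * f (z t) + w t ^ 2 =
            z 0 * f (z 0) * r t * ρ t * Real.sin (ψ t - φ t) := by
          rw [Real.sin_sub, sq, show f (z t) = f (z 0) * (ρ t * Real.sin (ψ t)) by linarith]
          nth_rewrite 2 [e2]
          rw [e3, e1]
          ring
        rw [this, hs, mul_zero]
      by_cases hzt : z t = 0
      · have hcos := not_not.1 (mt (hziff t ht).2 (not_not.2 hzt))
        have h1 := Real.sin_sq_add_cos_sq (φ t)
        have hw' : w t = 0 := by rw [hzt] at hprod; simpa using hprod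
        rw [hw'] at e2
        have : Real.sin (φ t) = 0 := by simpa [hk, (hr t).ne'] using e2
        rw [hcos, this] at h1
        norm_num at h1
      · nlinarith [hf3 _ hzt, sq_nonneg (w t)]
    have hψφ : ψ 1 < φ 1 + Real.pi := by
      by_contra! hge
      have hcont : ContinuousOn (fun t => ψ t - φ t) (Icc 0 1) :=
        (hψ.continuous.sub hφ.continuous).continuousOn
      obtain ⟨t, ht, e⟩ := intermediate_value_Icc zero_le_one hcont
        (show Real.pi ∈ Icc (ψ 0 - φ 0) (ψ 1 - φ 1) from
          ⟨by rw [hψ0, hφ0]; linarith, by linarith⟩)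
      refine hsin t ht ?_
      have e' : ψ t - φ t = Real.pi := e
      rw [e', Real.sin_pi]
    rw [hφ1] at hψφ
    linarith

/-! ### Distributional identities on the interval -/

lemma integral_Ioo_eq_intervalIntegral (F : ℝ → ℝ) :
    ∫ t in Ioo (0 : ℝ) 1, F t = ∫ t in (0 : ℝ)..1, F t := by
  rw [intervalIntegral.integral_of_le zero_le_one, integral_Ioc_eq_integral_Ioo]

lemma contDiff_primitive {ζ : ℝ → ℝ} (hζ : ContDiff ℝ (⊤ : ℕ∞) ζ) (a : ℝ) :
    ContDiff ℝ (⊤ : ℕ∞) fun t => ∫ s in a..t, ζ s := by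
  have hd : ∀ t, HasDerivAt (fun t => ∫ s in a..t, ζ s) (ζ t) t := fun t =>
    (hζ.continuous.integral_hasStrictDerivAt a t).hasDerivAt
  rw [contDiff_infty_iff_deriv]
  refine ⟨fun t => (hd t).differentiableAt, ?_⟩
  rwa [show deriv (fun t => ∫ s in a..t, ζ s) = ζ from funext fun t => (hd t).deriv]

/-- `ζ ∈ C_c^∞((0, ∞))`. -/
structure IsHalfLineTest (ζ : ℝ → ℝ) : Prop where
  contDiff : ContDiff ℝ (⊤ : ℕ∞) ζ
  hasCompactSupport : HasCompactSupport ζ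
  tsupport_subset : tsupport ζ ⊆ Ioi 0

lemma IsHalfLineTest.apply_zero {ζ : ℝ → ℝ} (hζ : IsHalfLineTest ζ) : ζ 0 = 0 :=
  image_eq_zero_of_notMem_tsupport fun h => lt_irrefl (0 : ℝ) (hζ.tsupport_subset h)

lemma IsHalfLineTest.continuous {ζ : ℝ → ℝ} (hζ : IsHalfLineTest ζ) : Continuous ζ :=
  hζ.contDiff.continuous

lemma IsHalfLineTest.continuous_deriv {ζ : ℝ → ℝ} (hζ : IsHalfLineTest ζ) :
    Continuous (deriv ζ) := hζ.contDiff.continuous_deriv (by simp)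

lemma IsHalfLineTest.hasDerivAt {ζ : ℝ → ℝ} (hζ : IsHalfLineTest ζ) (t : ℝ) :
    HasDerivAt ζ (deriv ζ t) t :=
  (hζ.contDiff.differentiable (by simp) t).hasDerivAt

/-- A function the distributional derivative of which vanishes on `(0, 1)`, with a zero boundary
value at `1`, is zero: on `(0, 1)` the derivatives of the admissible test functions exhaust
`C_c^∞((0, 1))`. -/
lemma ae_eq_zero_of_integral_mul_deriv_eq_zero {w : ℝ → ℝ} (hw : IntegrableOn w (Ioo 0 1))
    (h : ∀ ζ, IsHalfLineTest ζ → ∫ t in Ioo (0 : ℝ) 1, w t * deriv ζ t = 0) :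
    ∀ᵐ t ∂volume.restrict (Ioo (0 : ℝ) 1), w t = 0 := by
  rw [ae_restrict_iff' measurableSet_Ioo]
  refine isOpen_Ioo.ae_eq_zero_of_integral_contDiff_smul_eq_zero hw.locallyIntegrableOn
    fun g hg hgc hgs => ?_
  obtain ⟨ε, hε, hgε⟩ : ∃ ε > 0, ∀ t < ε, g t = 0 := by
    rcases (tsupport g).eq_empty_or_nonempty with he | hne
    · exact ⟨1, one_pos, fun t _ => image_eq_zero_of_notMem_tsupport (by simp [he])⟩
    · obtain ⟨a, ha, hamin⟩ := hgc.isCompact.exists_isLeast hne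
      exact ⟨a, (hgs ha).1, fun t hta =>
        image_eq_zero_of_notMem_tsupport fun hm => absurd (hamin hm) (not_le.2 hta)⟩
  set χ : ContDiffBump (0 : ℝ) := ⟨1, 2, one_pos, one_lt_two⟩
  set ζ : ℝ → ℝ := fun t => χ t * ∫ s in (0 : ℝ)..t, g s with hζ
  have hζ0 : ∀ t < ε, ζ t = 0 := by
    intro t ht
    have : ∫ s in (0 : ℝ)..t, g s = 0 := by
      apply intervalIntegral.integral_zero_ae
      refine Eventually.of_forall fun s hs => hgε s ?_
      rw [mem_uIoc] at hs
      rcases hs with hs | hs <;> linarith [hs.1, hs.2]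
    rw [hζ]; simp [this]
  have htest : IsHalfLineTest ζ := by
    refine ⟨χ.contDiff.mul (contDiff_primitive hg 0), χ.hasCompactSupport.mul_right, ?_⟩
    have : tsupport ζ ⊆ Ici ε := closure_minimal (fun t ht => by
      by_contra hlt
      exact ht (hζ0 t (not_le.1 hlt))) isClosed_Ici
    exact this.trans fun t ht => hε.trans_le ht
  have hderiv : ∀ t ∈ Ioo (0 : ℝ) 1, deriv ζ t = g t := by
    intro t ht
    have hev : ζ =ᶠ[𝓝 t] fun t => ∫ s in (0 : ℝ)..t, g s := by
      filter_upwards [isOpen_Ioo.mem_nhds ht] with s hs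
      have : χ s = 1 := χ.one_of_mem_closedBall (by
        rw [Metric.mem_closedBall, Real.dist_eq, sub_zero, abs_of_pos hs.1]; exact hs.2.le)
      simp [hζ, this]
    rw [hev.deriv_eq]
    exact hg.continuous.deriv_integral _ _ _
  rw [← h ζ htest, ← setIntegral_eq_integral_of_forall_compl_eq_zero (s := Ioo (0 : ℝ) 1)]
  · refine setIntegral_congr_fun measurableSet_Ioo fun t ht => ?_
    simp only [hderiv t ht, smul_eq_mul, mul_comm]
  · intro t ht
    rw [image_eq_zero_of_notMem_tsupport fun hm => ht (hgs hm), zero_smul]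

lemma integrableOn_Ioo_of_continuous {F : ℝ → ℝ} (hF : Continuous F) :
    IntegrableOn F (Ioo 0 1) :=
  (hF.continuousOn.integrableOn_Icc (a := 0) (b := 1)).mono_set Ioo_subset_Icc_self

lemma ae_eq_of_integral_mul_deriv_eq {w W : ℝ → ℝ} (hw : IntegrableOn w (Ioo 0 1))
    (hW : Continuous W)
    (h : ∀ ζ, IsHalfLineTest ζ → ∫ t in Ioo (0 : ℝ) 1, w t * deriv ζ t =
      ∫ t in (0 : ℝ)..1, W t * deriv ζ t) :
    w =ᵐ[volume.restrict (Ioo (0 : ℝ) 1)] W := by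
  have hWi : IntegrableOn W (Ioo 0 1) := integrableOn_Ioo_of_continuous hW
  have hsub := ae_eq_zero_of_integral_mul_deriv_eq_zero (w := fun t => w t - W t) (hw.sub hWi)
    fun ζ hζ => ?_
  · filter_upwards [hsub] with t ht
    exact sub_eq_zero.1 ht
  · obtain ⟨C, hC⟩ := (isCompact_Icc (a := (0 : ℝ)) (b := 1)).exists_bound_of_continuousOn
      hζ.continuous_deriv.continuousOn
    have h1 : Integrable (fun t => w t * deriv ζ t) (volume.restrict (Ioo (0 : ℝ) 1)) :=
      hw.mul_bdd hζ.continuous_deriv.aestronglyMeasurable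
        ((ae_restrict_mem measurableSet_Ioo).mono fun t ht => hC t (Ioo_subset_Icc_self ht))
    have h2 : Integrable (fun t => W t * deriv ζ t) (volume.restrict (Ioo (0 : ℝ) 1)) :=
      integrableOn_Ioo_of_continuous (hW.mul hζ.continuous_deriv)
    simp_rw [sub_mul]
    rw [integral_sub h1 h2, h ζ hζ, ← integral_Ioo_eq_intervalIntegral, sub_self]

/-- A function with an integrable distributional derivative has a continuous representative. -/
lemma exists_continuous_ae_eq {w g : ℝ → ℝ} (hw : IntegrableOn w (Ioo 0 1))
    (hg : IntegrableOn g (Ioo 0 1))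
    (h : ∀ ζ, IsHalfLineTest ζ → ∫ t in Ioo (0 : ℝ) 1, w t * deriv ζ t =
      -∫ t in Ioo (0 : ℝ) 1, g t * ζ t) :
    ∃ W : ℝ → ℝ, Continuous W ∧ w =ᵐ[volume.restrict (Ioo (0 : ℝ) 1)] W := by
  set G : ℝ → ℝ := (Ioo (0 : ℝ) 1).indicator g with hG
  have hGi : Integrable G := hg.integrable_indicator measurableSet_Ioo
  set W : ℝ → ℝ := fun t => ∫ s in (1 : ℝ)..t, G s with hW
  have hWc : Continuous W := intervalIntegral.continuous_primitive
    (fun a b => hGi.intervalIntegrable) 1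
  refine ⟨W, hWc, ae_eq_of_integral_mul_deriv_eq hw hWc fun ζ hζ => ?_⟩
  have hac : AbsolutelyContinuousOnInterval W 0 1 :=
    (hGi.intervalIntegrable (a := 0) (b := 1)).absolutelyContinuousOnInterval_intervalIntegral
      (by simp)
  have hζac : AbsolutelyContinuousOnInterval ζ 0 1 :=
    ((hζ.contDiff.of_le (by simp)).contDiffOn (s := uIcc 0 1)).absolutelyContinuousOnInterval
  have hparts := hac.integral_mul_deriv_eq_deriv_mul hζac
  have hW1 : W 1 = 0 := by simp [hW]
  rw [hW1, hζ.apply_zero, zero_mul, mul_zero, sub_zero, zero_sub] at hparts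
  rw [h ζ hζ, hparts, neg_inj, integral_Ioo_eq_intervalIntegral,
    intervalIntegral.integral_of_le zero_le_one, intervalIntegral.integral_of_le zero_le_one,
    integral_Ioc_eq_integral_Ioo, integral_Ioc_eq_integral_Ioo]
  refine setIntegral_congr_ae measurableSet_Ioo ?_
  filter_upwards [(hGi.intervalIntegrable (a := 0) (b := 1)).ae_hasDerivAt_integral] with t ht hmem
  have := ht (by rw [uIcc_of_le zero_le_one]; exact Ioo_subset_Icc_self hmem) 1 (by simp)
  rw [this.deriv, hG, indicator_of_mem hmem]

/-! ### One-dimensional functions on the cylinder -/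

lemma restrict_cylinder (ω : Set (EuclideanSpace ℝ (Fin d))) :
    (volume : Measure (Pt d)).restrict (cylinder ω) =
      (volume.restrict ω).prod (volume.restrict (Ioo (0 : ℝ) 1)) := by
  rw [Measure.prod_restrict, ← Measure.volume_eq_prod]; rfl

lemma isFiniteMeasure_restrict_cylinder {ω : Set (EuclideanSpace ℝ (Fin d))}
    (hb : Bornology.IsBounded ω) :
    IsFiniteMeasure ((volume : Measure (Pt d)).restrict (cylinder ω)) :=
  ⟨by
    rw [Measure.restrict_apply_univ]
    exact (hb.prod (Metric.isBounded_Ioo 0 1)).measure_lt_top⟩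

lemma measurableSet_cylinder {ω : Set (EuclideanSpace ℝ (Fin d))} (hω : IsOpen ω) :
    MeasurableSet (cylinder ω) := (hω.prod isOpen_Ioo).measurableSet

lemma setIntegral_cylinder_comp_snd (ω : Set (EuclideanSpace ℝ (Fin d))) (F : ℝ → ℝ) :
    ∫ x in cylinder ω, F x.2 = volume.real ω * ∫ t in Ioo (0 : ℝ) 1, F t := by
  have := integral_prod_mul (μ := volume.restrict ω) (ν := volume.restrict (Ioo (0 : ℝ) 1))
    (fun _ => (1 : ℝ)) F
  rw [restrict_cylinder]
  simpa using this

lemma hasDerivAt_slice {φ : Pt d → ℝ} (hφ : Differentiable ℝ φ)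
    (y : EuclideanSpace ℝ (Fin d)) (t : ℝ) :
    HasDerivAt (fun t => φ (y, t)) (fderiv ℝ φ (y, t) (0, 1)) t :=
  (hφ (y, t)).hasFDerivAt.comp_hasDerivAt t ((hasDerivAt_const t y).prodMk (hasDerivAt_id t))

lemma hasFDerivAt_comp_snd {η : ℝ → ℝ} (hη : Differentiable ℝ η) (x : Pt d) :
    HasFDerivAt (fun x : Pt d => η x.2)
      (deriv η x.2 • ContinuousLinearMap.snd ℝ (EuclideanSpace ℝ (Fin d)) ℝ) x :=
  (hη x.2).hasDerivAt.comp_hasFDerivAt x hasFDerivAt_snd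

lemma memLp_of_continuous_comp_snd {E : Type*} [NormedAddCommGroup E]
    {ω : Set (EuclideanSpace ℝ (Fin d))} (hω : IsOpen ω) (hb : Bornology.IsBounded ω)
    {F : ℝ → E} (hF : Continuous F) :
    MemLp (fun x : Pt d => F x.2) 2 (volume.restrict (cylinder ω)) := by
  have := isFiniteMeasure_restrict_cylinder hb
  obtain ⟨C, hC⟩ := (isCompact_Icc (a := (0 : ℝ)) (b := 1)).exists_bound_of_continuousOn
    hF.continuousOn
  refine MemLp.of_bound (C := C)
    (hF.comp_stronglyMeasurable measurable_snd.stronglyMeasurable).aestronglyMeasurable ?_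
  filter_upwards [ae_restrict_mem (measurableSet_cylinder hω)] with x hx
  exact hC _ (Ioo_subset_Icc_self hx.2)

/-- A smooth function of `x_N` vanishing at `x_N = 1` belongs to `H¹₀(Ω_ω ∪ Γ)`. -/
lemma isH10_lift {ω : Set (EuclideanSpace ℝ (Fin d))} (hω : IsOpen ω)
    (hb : Bornology.IsBounded ω) {η : ℝ → ℝ} (hη : ContDiff ℝ (⊤ : ℕ∞) η) (hη1 : η 1 = 0) :
    IsH10 ω (lift d η) (fun x => (0, deriv η x.2)) := by
  have hηd : Differentiable ℝ η := hη.differentiable (by simp)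
  have hη' : Continuous (deriv η) := hη.continuous_deriv (by simp)
  have hηc := hη.continuous
  refine ⟨⟨memLp_of_continuous_comp_snd hω hb hη.continuous,
    memLp_of_continuous_comp_snd hω hb (F := fun t => ((0, deriv η t) : Pt d)) (by fun_prop),
    fun φ hφ e => ?_⟩, ?_, fun φ hφ => ?_⟩
  · obtain ⟨hφs, hφc, hφt⟩ := hφ
    have hφcont := hφs.continuous
    have hφd : Differentiable ℝ φ := hφs.differentiable (by simp)
    have hφ' : Continuous fun x => fderiv ℝ φ x e :=
      (hφs.continuous_fderiv (by simp)).clm_apply continuous_const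
    have hφ'c : HasCompactSupport fun x => fderiv ℝ φ x e := hφc.fderiv_apply (𝕜 := ℝ) e
    have hfd : ∀ x : Pt d, fderiv ℝ (fun x : Pt d => η x.2) x e = deriv η x.2 * e.2 := fun x => by
      rw [(hasFDerivAt_comp_snd hηd x).fderiv]; simp
    have : (volume : Measure (Pt d)).IsAddHaarMeasure := by
      rw [Measure.volume_eq_prod]; infer_instance
    have key := integral_mul_fderiv_eq_neg_fderiv_mul_of_integrable (μ := (volume : Measure (Pt d)))
      (f := fun x : Pt d => η x.2) (g := φ) (v := e)
      (by
        simp_rw [hfd]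
        exact Continuous.integrable_of_hasCompactSupport (by fun_prop) hφc.mul_left)
      (Continuous.integrable_of_hasCompactSupport (by fun_prop) hφ'c.mul_left)
      (Continuous.integrable_of_hasCompactSupport (by fun_prop) hφc.mul_left)
      (fun x _ => (hasFDerivAt_comp_snd hηd x).differentiableAt) (fun x _ => hφd x)
    rw [setIntegral_eq_integral_of_forall_compl_eq_zero fun x hx => ?_,
      setIntegral_eq_integral_of_forall_compl_eq_zero fun x hx => ?_]
    · refine key.trans ?_
      congr 1
      refine integral_congr_ae (Eventually.of_forall fun x => ?_)
      simp [hfd, dot]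
    · rw [image_eq_zero_of_notMem_tsupport fun hm => hx (hφt hm), mul_zero]
    · have : fderiv ℝ φ x = 0 := image_eq_zero_of_notMem_tsupport fun hm =>
        hx (hφt (tsupport_fderiv_subset ℝ hm))
      rw [this]; simp
  · exact (locallyIntegrable_const (0 : ℝ)).locallyIntegrableOn _
  · obtain ⟨hφs, hφc, hφt⟩ := hφ
    have hφcont := hφs.continuous
    have hφd : Differentiable ℝ φ := hφs.differentiable (by simp)
    have hφ' : Continuous fun x => fderiv ℝ φ x (0, 1) :=
      (hφs.continuous_fderiv (by simp)).clm_apply continuous_const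
    have hφ'c : HasCompactSupport fun x => fderiv ℝ φ x (0, 1) := hφc.fderiv_apply (𝕜 := ℝ) _
    have h1 : Integrable (fun x : Pt d => η x.2 * fderiv ℝ φ x (0, 1))
        (volume.restrict (cylinder ω)) :=
      (Continuous.integrable_of_hasCompactSupport (by fun_prop) hφ'c.mul_left).restrict
    have h2 : Integrable (fun x : Pt d => deriv η x.2 * φ x) (volume.restrict (cylinder ω)) :=
      (Continuous.integrable_of_hasCompactSupport (by fun_prop) hφc.mul_left).restrict
    have hsum : ∫ x in cylinder ω, (η x.2 * fderiv ℝ φ x (0, 1) + deriv η x.2 * φ x) = 0 := by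
      have h12 := h1.add h2
      rw [restrict_cylinder] at h12 ⊢
      refine (integral_prod _ h12).trans ?_
      refine integral_eq_zero_of_ae (Eventually.of_forall fun y => ?_)
      simp only [Pi.zero_apply, Pi.add_apply]
      rw [integral_Ioo_eq_intervalIntegral,
        intervalIntegral.integral_eq_sub_of_hasDerivAt (f := fun t => η t * φ (y, t))
          (fun t _ => (((hηd t).hasDerivAt).mul (hasDerivAt_slice hφd y t)).congr_deriv
            (add_comm _ _))]
      · have : φ (y, 0) = 0 := image_eq_zero_of_notMem_tsupport fun hm =>
          lt_irrefl (0 : ℝ) (hφt hm).2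
        simp [this, hη1]
      · have := hφ'.comp (Continuous.prodMk_right y)
        exact Continuous.intervalIntegrable (by fun_prop) _ _
    rw [integral_add h1 h2] at hsum
    simp only [lift, zero_mul, integral_zero]
    linarith

/-- For a one-dimensional `u ∈ H¹₀(Ω_ω ∪ Γ)` the integrals `∫ ∂_N u(x', t) ζ(t) dt` do not depend
on `x'`, because their mean values against test functions of `x'` are all equal. -/
lemma IsH10.integral_grad_mul {ω : Set (EuclideanSpace ℝ (Fin d))} (hω : IsOpen ω)
    (hb : Bornology.IsBounded ω) {u : Pt d → ℝ} {G : Pt d → Pt d} (hu : IsH10 ω u G) {w : ℝ → ℝ}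
    (huw : ∀ᵐ x ∂volume.restrict (cylinder ω), u x = w x.2) {ζ : ℝ → ℝ} (hζ : IsHalfLineTest ζ) :
    ∫ x in cylinder ω, (G x).2 * ζ x.2 =
      -(volume.real ω * ∫ t in Ioo (0 : ℝ) 1, w t * deriv ζ t) := by
  have := isFiniteMeasure_restrict_cylinder hb
  have : IsFiniteMeasure (volume.restrict ω) :=
    ⟨by rw [Measure.restrict_apply_univ]; exact hb.measure_lt_top⟩
  obtain ⟨B, hB⟩ := hζ.continuous.bounded_above_of_compact_support hζ.hasCompactSupport
  have hζc := hζ.continuous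
  have hG2 : Integrable (fun x => (G x).2) (volume.restrict (cylinder ω)) :=
    (hu.1.memLp_grad.integrable one_le_two).snd
  have hGζ : Integrable (fun x => (G x).2 * ζ x.2) (volume.restrict (cylinder ω)) :=
    hG2.mul_bdd (by fun_prop) (Eventually.of_forall fun x => hB x.2)
  have hGζ' := hGζ
  rw [restrict_cylinder] at hGζ'
  set m : EuclideanSpace ℝ (Fin d) → ℝ :=
    fun y => ∫ t in Ioo (0 : ℝ) 1, (G (y, t)).2 * ζ t with hm
  have hmi : IntegrableOn m ω := hGζ'.integral_prod_left
  set c : ℝ := -∫ t in Ioo (0 : ℝ) 1, w t * deriv ζ t with hc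
  have hmc : ∀ᵐ y, y ∈ ω → m y - c = 0 := by
    have hci : IntegrableOn (fun _ : EuclideanSpace ℝ (Fin d) => c) ω :=
      integrableOn_const hb.measure_lt_top.ne
    refine hω.ae_eq_zero_of_integral_contDiff_smul_eq_zero (hmi.sub hci).locallyIntegrableOn
      fun ψ hψ hψc hψs => ?_
    have hψcont := hψ.continuous
    have hζd : Differentiable ℝ ζ := hζ.contDiff.differentiable (by simp)
    have hψd : Differentiable ℝ ψ := hψ.differentiable (by simp)
    set φ : Pt d → ℝ := fun x => ψ x.1 * ζ x.2 with hφ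
    have hzero : ∀ x ∉ tsupport ψ ×ˢ tsupport ζ, φ x = 0 := by
      intro x hx
      simp only [hφ]
      by_cases h1 : x.1 ∈ tsupport ψ
      · rw [image_eq_zero_of_notMem_tsupport (f := ζ) fun h2 => hx ⟨h1, h2⟩, mul_zero]
      · rw [image_eq_zero_of_notMem_tsupport h1, zero_mul]
    have hK : IsCompact (tsupport ψ ×ˢ tsupport ζ) :=
      hψc.isCompact.prod hζ.hasCompactSupport.isCompact
    have htest : IsTestFunction (halfCylinder ω) φ := by
      refine ⟨(hψ.comp contDiff_fst).mul (hζ.contDiff.comp contDiff_snd),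
        HasCompactSupport.intro hK hzero, ?_⟩
      refine (closure_minimal (fun x hx => ?_) hK.isClosed).trans
        (prod_mono hψs hζ.tsupport_subset)
      by_contra hn
      exact hx (hzero x hn)
    have htr := hu.2.2 φ htest
    have hfd : ∀ x : Pt d, fderiv ℝ φ x (0, 1) = ψ x.1 * deriv ζ x.2 := by
      intro x
      have h1 := hasDerivAt_slice (htest.1.differentiable (by simp)) x.1 x.2
      exact h1.unique ((hζ.hasDerivAt x.2).const_mul (ψ x.1))
    have hL : ∫ x in cylinder ω, u x * fderiv ℝ φ x (0, 1) = -((∫ y in ω, ψ y) * c) := by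
      have : ∫ x in cylinder ω, u x * fderiv ℝ φ x (0, 1) =
          ∫ x in cylinder ω, ψ x.1 * (w x.2 * deriv ζ x.2) := by
        refine integral_congr_ae ?_
        filter_upwards [huw] with x hx
        rw [hx, hfd]; ring
      rw [this, restrict_cylinder, integral_prod_mul ψ fun t => w t * deriv ζ t, hc]
      ring
    obtain ⟨Bψ, hBψ⟩ := hψcont.bounded_above_of_compact_support hψc
    have hR : ∫ x in cylinder ω, (G x).2 * φ x = ∫ y in ω, ψ y * m y := by
      have hi : Integrable (fun x => ψ x.1 * ((G x).2 * ζ x.2))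
          (volume.restrict (cylinder ω)) :=
        hGζ.bdd_mul (by fun_prop) (Eventually.of_forall fun x => hBψ x.1)
      have : ∫ x in cylinder ω, (G x).2 * φ x =
          ∫ x in cylinder ω, ψ x.1 * ((G x).2 * ζ x.2) :=
        integral_congr_ae (Eventually.of_forall fun x => by simp only [hφ]; ring)
      rw [this]
      rw [restrict_cylinder] at hi ⊢
      refine (integral_prod _ hi).trans ?_
      refine integral_congr_ae (Eventually.of_forall fun y => ?_)
      exact integral_const_mul (ψ y) fun t => (G (y, t)).2 * ζ t
    have hψm : Integrable (fun y => ψ y * m y) (volume.restrict ω) :=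
      hmi.bdd_mul (by fun_prop) (Eventually.of_forall hBψ)
    have hψi : Integrable ψ (volume.restrict ω) :=
      (hψcont.integrable_of_hasCompactSupport hψc).restrict
    rw [hL, hR] at htr
    simp only [zero_mul, integral_zero, zero_sub, neg_inj] at htr
    rw [← setIntegral_eq_integral_of_forall_compl_eq_zero (s := ω) fun y hy => by
      rw [image_eq_zero_of_notMem_tsupport fun h => hy (hψs h), zero_smul]]
    simp only [smul_eq_mul, mul_sub]
    rw [integral_sub hψm (hψi.mul_const c), integral_mul_const, htr, sub_self]
  rw [restrict_cylinder]
  refine (integral_prod _ hGζ').trans ?_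
  have : ∫ y in ω, m y = ∫ y in ω, c := by
    refine setIntegral_congr_ae hω.measurableSet ?_
    filter_upwards [hmc] with y hy hyω
    exact sub_eq_zero.1 (hy hyω)
  refine this.trans ?_
  rw [setIntegral_const, smul_eq_mul, hc]
  ring

lemma measureReal_pos_of_isOpen {ω : Set (EuclideanSpace ℝ (Fin d))} (hω : IsOpen ω)
    (hne : ω.Nonempty) (hb : Bornology.IsBounded ω) : 0 < volume.real ω :=
  ENNReal.toReal_pos (hω.measure_pos volume hne).ne' hb.measure_lt_top.ne

lemma ae_comp_snd_cylinder {ω : Set (EuclideanSpace ℝ (Fin d))} {p : ℝ → Prop}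
    (h : ∀ᵐ t ∂volume.restrict (Ioo (0 : ℝ) 1), p t) :
    ∀ᵐ x ∂volume.restrict (cylinder ω), p x.2 := by
  rw [restrict_cylinder]
  exact Measure.quasiMeasurePreserving_snd.ae h

lemma IsH10.integrableOn_profile {ω : Set (EuclideanSpace ℝ (Fin d))} (hω : IsOpen ω)
    (hne : ω.Nonempty) (hb : Bornology.IsBounded ω) {u : Pt d → ℝ} {G : Pt d → Pt d}
    (hu : IsH10 ω u G) {w : ℝ → ℝ} (huw : ∀ᵐ x ∂volume.restrict (cylinder ω), u x = w x.2) :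
    IntegrableOn w (Ioo 0 1) := by
  have := isFiniteMeasure_restrict_cylinder hb
  have hui := hu.1.memLp.integrable one_le_two
  rw [restrict_cylinder] at hui huw
  have : (ae (volume.restrict ω)).NeBot := by
    rw [ae_neBot, Ne, Measure.restrict_eq_zero]
    exact (hω.measure_pos volume hne).ne'
  obtain ⟨y, hy1, hy2⟩ := (hui.prod_right_ae.and (Measure.ae_ae_of_ae_prod huw)).exists
  exact hy1.congr hy2

/-- The profile of a one-dimensional function in `H¹₀(Ω_ω ∪ Γ)` has a continuous representative. -/
lemma IsH10.exists_continuous_profile {ω : Set (EuclideanSpace ℝ (Fin d))} (hω : IsOpen ω)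
    (hne : ω.Nonempty) (hb : Bornology.IsBounded ω) {u : Pt d → ℝ} {G : Pt d → Pt d}
    (hu : IsH10 ω u G) {w : ℝ → ℝ} (huw : ∀ᵐ x ∂volume.restrict (cylinder ω), u x = w x.2) :
    ∃ W : ℝ → ℝ, Continuous W ∧ w =ᵐ[volume.restrict (Ioo (0 : ℝ) 1)] W := by
  have := isFiniteMeasure_restrict_cylinder hb
  have : IsFiniteMeasure (volume.restrict ω) :=
    ⟨by rw [Measure.restrict_apply_univ]; exact hb.measure_lt_top⟩
  have hV := measureReal_pos_of_isOpen hω hne hb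
  have hG2 : Integrable (fun x => (G x).2) (volume.restrict (cylinder ω)) :=
    (hu.1.memLp_grad.integrable one_le_two).snd
  have hG2' := hG2
  rw [restrict_cylinder] at hG2'
  -- the derivative of the profile is the mean value of `∂_N u` over the cross section
  refine exists_continuous_ae_eq (hu.integrableOn_profile hω hne hb huw)
    (g := fun t => (volume.real ω)⁻¹ * ∫ y in ω, (G (y, t)).2)
    (hG2'.integral_prod_right.const_mul _) fun ζ hζ => ?_
  obtain ⟨B, hB⟩ := hζ.continuous.bounded_above_of_compact_support hζ.hasCompactSupport
  have hζc := hζ.continuous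
  have hGζ : Integrable (fun x => (G x).2 * ζ x.2) (volume.restrict (cylinder ω)) :=
    hG2.mul_bdd (by fun_prop) (Eventually.of_forall fun x => hB x.2)
  have key := hu.integral_grad_mul hω hb huw hζ
  rw [restrict_cylinder] at hGζ key
  rw [integral_prod_symm _ hGζ] at key
  simp_rw [integral_mul_const] at key
  simp_rw [mul_assoc, integral_const_mul, key]
  field_simp

/-- A one-dimensional weak solution of `-Δu = k(x_N)` with the mixed boundary conditions is a
classical solution of the two-point boundary value problem `-z'' = k`, `z'(0) = z(1) = 0`. -/
lemma IsH10.exists_classical_profile {ω : Set (EuclideanSpace ℝ (Fin d))} (hω : IsOpen ω)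
    (hne : ω.Nonempty) (hb : Bornology.IsBounded ω) {u : Pt d → ℝ} {G : Pt d → Pt d}
    (hu : IsH10 ω u G) {w k : ℝ → ℝ} (huw : ∀ᵐ x ∂volume.restrict (cylinder ω), u x = w x.2)
    (hk : Continuous k)
    (hweak : ∀ η : ℝ → ℝ, ContDiff ℝ (⊤ : ℕ∞) η → η 1 = 0 →
      ∫ x in cylinder ω, (G x).2 * deriv η x.2 = ∫ x in cylinder ω, k x.2 * η x.2) :
    ∃ z z' : ℝ → ℝ, Continuous z ∧ Continuous z' ∧ (∀ t, HasDerivAt z (z' t) t) ∧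
      (∀ t, HasDerivAt z' (-k t) t) ∧ z' 0 = 0 ∧ z 1 = 0 ∧
      w =ᵐ[volume.restrict (Ioo (0 : ℝ) 1)] z := by
  have hV := measureReal_pos_of_isOpen hω hne hb
  set z' : ℝ → ℝ := fun t => ∫ s in (0 : ℝ)..t, -k s with hz'
  have hz'd : ∀ t, HasDerivAt z' (-k t) t := fun t =>
    (hk.neg.integral_hasStrictDerivAt 0 t).hasDerivAt
  have hz'c : Continuous z' := continuous_iff_continuousAt.2 fun t => (hz'd t).continuousAt
  set z : ℝ → ℝ := fun t => ∫ s in (1 : ℝ)..t, z' s with hz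
  have hzd : ∀ t, HasDerivAt z (z' t) t := fun t =>
    (hz'c.integral_hasStrictDerivAt 1 t).hasDerivAt
  have hzc : Continuous z := continuous_iff_continuousAt.2 fun t => (hzd t).continuousAt
  have hz'0 : z' 0 = 0 := by simp [hz']
  have hz1 : z 1 = 0 := by simp [hz]
  refine ⟨z, z', hzc, hz'c, hzd, hz'd, hz'0, hz1,
    ae_eq_of_integral_mul_deriv_eq (hu.integrableOn_profile hω hne hb huw) hzc fun ζ hζ => ?_⟩
  set η : ℝ → ℝ := fun t => ∫ s in (1 : ℝ)..t, ζ s with hη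
  have hηd : ∀ t, HasDerivAt η (ζ t) t := fun t =>
    (hζ.continuous.integral_hasStrictDerivAt 1 t).hasDerivAt
  have hη1 : η 1 = 0 := by simp [hη]
  have h1 := hweak η (contDiff_primitive hζ.contDiff 1) hη1
  simp_rw [fun t => (hηd t).deriv] at h1
  rw [hu.integral_grad_mul hω hb huw hζ, setIntegral_cylinder_comp_snd ω fun t => k t * η t,
    integral_Ioo_eq_intervalIntegral (fun t => k t * η t)] at h1
  have h2 := intervalIntegral.integral_mul_deriv_eq_deriv_mul (a := 0) (b := 1)
    (fun t _ => hzd t) (fun t _ => hζ.hasDerivAt t) (hz'c.intervalIntegrable _ _)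
    (hζ.continuous_deriv.intervalIntegrable _ _)
  have h3 := intervalIntegral.integral_mul_deriv_eq_deriv_mul (a := 0) (b := 1)
    (fun t _ => hz'd t) (fun t _ => hηd t) (hk.neg.intervalIntegrable _ _)
    (hζ.continuous.intervalIntegrable _ _)
  rw [hz1, hζ.apply_zero] at h2
  rw [hη1, hz'0] at h3
  simp only [neg_mul, intervalIntegral.integral_neg] at h3
  have h4 : volume.real ω * ((∫ t in Ioo (0 : ℝ) 1, w t * deriv ζ t) +
      ∫ t in (0 : ℝ)..1, k t * η t) = 0 := by linarith
  have h5 := (mul_eq_zero.1 h4).resolve_left hV.ne'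
  linarith

/-! ### Weak solutions and their linearization -/

/-- A continuous one-dimensional weak solution is a classical solution of the two-point boundary
value problem, the profile being understood through its continuous extension to `[0, 1]`. -/
lemma IsWeakSolution.exists_classical {ω : Set (EuclideanSpace ℝ (Fin d))} (hω : IsOpen ω)
    (hne : ω.Nonempty) (hb : Bornology.IsBounded ω) {f : ℝ → ℝ} (hf : Continuous f) {U : ℝ → ℝ}
    (hU : ContinuousOn U (Ioo 0 1)) (hsol : IsWeakSolution ω f (lift d U)) :
    ∃ z z' : ℝ → ℝ, Continuous z ∧ Continuous z' ∧ (∀ t, HasDerivAt z (z' t) t) ∧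
      (∀ t ∈ Ioo (0 : ℝ) 1, HasDerivAt z' (-f (z t)) t) ∧ z' 0 = 0 ∧ z 1 = 0 ∧
      EqOn U z (Ioo 0 1) := by
  obtain ⟨G, hu, hweak⟩ := hsol
  have huw : ∀ᵐ x ∂volume.restrict (cylinder ω), lift d U x = U x.2 :=
    Eventually.of_forall fun _ => rfl
  obtain ⟨W, hWc, hW⟩ := hu.exists_continuous_profile hω hne hb huw
  have hUW := Measure.eqOn_Ioo_of_ae_eq volume hW hU hWc.continuousOn
  obtain ⟨z, z', hz, hz', hzd, hz'd, hz'0, hz1, hUz⟩ :=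
    hu.exists_classical_profile hω hne hb huw (hf.comp hWc) fun η hη hη1 => by
      have h := (hweak _ _ (isH10_lift hω hb hη hη1)).2
      have h1 : ∫ x in cylinder ω, dot (G x) (0, deriv η x.2) =
          ∫ x in cylinder ω, (G x).2 * deriv η x.2 := by simp [dot]
      have h2 : ∫ x in cylinder ω, f (lift d U x) * lift d η x =
          ∫ x in cylinder ω, (f ∘ W) x.2 * η x.2 :=
        setIntegral_congr_fun (measurableSet_cylinder hω) fun x hx => by
          simp only [lift, Function.comp_apply, hUW hx.2]
      linarith
  have hUz' := Measure.eqOn_Ioo_of_ae_eq volume hUz hU hz.continuousOn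
  refine ⟨z, z', hz, hz', hzd, fun t ht => ?_, hz'0, hz1, hUz'⟩
  have := hz'd t
  rwa [Function.comp_apply, ← hUW ht, hUz' ht] at this

/-- A one-dimensional element of the kernel of the linearized operator is an eigenfunction of the
Sturm–Liouville problem for the eigenvalue `0`. -/
lemma isNondegenerateOneDim_of_not_isEigenvalue {ω : Set (EuclideanSpace ℝ (Fin d))}
    (hω : IsOpen ω) (hne : ω.Nonempty) (hb : Bornology.IsBounded ω) {f U q : ℝ → ℝ}
    (hq : Continuous q) (hqU : ∀ t ∈ Ioo (0 : ℝ) 1, deriv f (U t) = q t)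
    (h0 : ¬ IsEigenvalue f U 0) : IsNondegenerateOneDim ω f (lift d U) := by
  rintro φ ⟨G, ⟨hφ, w, hφw⟩, hweak⟩
  obtain ⟨W, hWc, hW⟩ := hφ.exists_continuous_profile hω hne hb hφw
  have hφW : ∀ᵐ x ∂volume.restrict (cylinder ω), φ x = W x.2 := by
    filter_upwards [hφw, ae_comp_snd_cylinder (ω := ω) hW] with x h1 h2
    rw [h1, h2]
  obtain ⟨z, z', hz, hz', hzd, hz'd, hz'0, hz1, hWz⟩ :=
    hφ.exists_classical_profile hω hne hb hφW (hq.mul hWc) fun η hη hη1 => by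
      have h := (hweak _ _ ⟨isH10_lift hω hb hη hη1, η, Eventually.of_forall fun _ => rfl⟩).2
      have h1 : ∫ x in cylinder ω, dot (G x) (0, deriv η x.2) =
          ∫ x in cylinder ω, (G x).2 * deriv η x.2 := by simp [dot]
      have h2 : ∫ x in cylinder ω, deriv f (lift d U x) * φ x * lift d η x =
          ∫ x in cylinder ω, (q * W) x.2 * η x.2 := by
        refine integral_congr_ae ?_
        filter_upwards [hφW, ae_restrict_mem (measurableSet_cylinder hω)] with x h1 hx
        simp only [lift, h1, hqU _ hx.2, Pi.mul_apply]
      linarith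
  have hWz' := Measure.eqOn_Ioo_of_ae_eq volume hWz hWc.continuousOn hz.continuousOn
  have hzero : ∀ t ∈ Ioo (0 : ℝ) 1, z t = 0 := by
    by_contra! hex
    refine h0 ⟨z, z', hz.continuousOn, hz'.continuousOn, fun t _ => hzd t,
      fun t ht => ⟨_, hz'd t, ?_⟩, hz'0, hz1, hex⟩
    rw [hqU t ht, Pi.mul_apply, hWz' ht]; ring
  filter_upwards [hφW, ae_restrict_mem (measurableSet_cylinder hω)] with x h1 hx
  rw [h1, hWz' hx.2, hzero _ hx.2]

end Cylinder

open Cylinder in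
theorem mainTheorem5 (d : ℕ) (hd : 1 ≤ d) (ω : Set (EuclideanSpace ℝ (Fin d)))
    (hω_open : IsOpen ω) (hω_conn : IsConnected ω) (hω_bdd : Bornology.IsBounded ω)
    (f : ℝ → ℝ) (hf : ContDiff ℝ 1 f)
    (hf1 : ∀ s : ℝ, s ≠ 0 → f s / s < deriv f s)
    (hf3 : ∀ s : ℝ, s ≠ 0 → 0 < s * f s)
    (U : ℝ → ℝ) (hU : ContinuousOn U (Set.Ioo 0 1))
    (hU0 : ∃ t ∈ Set.Ioo (0 : ℝ) 1, U t ≠ 0)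
    (hsol : IsWeakSolution ω f (lift d U)) :
    IsNondegenerateOneDim ω f (lift d U) ∧
    ¬ IsEigenvalue f U 0 ∧
    ∃ n : ℕ, nodalCount ω (lift d U) = n ∧
      ∃ α : ℕ → ℝ, StrictMono α ∧ Set.range α = {a | IsEigenvalue f U a} ∧ 0 < α n := by
  obtain ⟨z, z', hz, hz', hzd, hz'd, hz'0, hz1, hUz⟩ :=
    hsol.exists_classical hω_open hω_conn.nonempty hω_bdd hf.continuous hU
  have hqc : Continuous fun t => deriv f (z t) := (hf.continuous_deriv le_rfl).comp hz
  have hqU : ∀ t ∈ Set.Ioo (0 : ℝ) 1, deriv f (U t) = deriv f (z t) := fun t ht => by rw [hUz ht]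
  choose Θ hΘ hΘ0 using fun a : ℝ =>
    exists_isPruferAngle (p := fun t => deriv f (z t) + a) (by fun_prop) 0
  obtain ⟨m, φ, hφ, hφmono, hφ0, hφ1, hzφ, hlo, hhi⟩ :=
    exists_angle_of_solution hf hf1 hf3 hz hz' (fun t _ => hzd t) hz'd hz'0 hz1
      (by obtain ⟨t, ht, hUt⟩ := hU0; exact ⟨t, ht, by rwa [← hUz ht]⟩)
      (θ := Θ 0) (by simpa using hΘ 0) (hΘ0 0)
  have hne : ¬ IsEigenvalue f U 0 := by
    rw [isEigenvalue_iff_cos_eq_zero hqc hqU (hΘ 0) (hΘ0 0), Real.cos_eq_zero_iff]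
    -- no odd multiple of `π/2` lies strictly between `π/2 + mπ` and `π/2 + (m + 1)π`
    rintro ⟨j, hj⟩
    rw [hj] at hlo hhi
    have h1 : ((m : ℤ) : ℝ) < j := by push_cast; nlinarith [Real.pi_pos]
    have h2 : (j : ℝ) < ((m + 1 : ℤ) : ℝ) := by push_cast; nlinarith [Real.pi_pos]
    have h1' := Int.cast_lt.1 h1
    have h2' := Int.cast_lt.1 h2
    omega
  refine ⟨isNondegenerateOneDim_of_not_isEigenvalue hω_open hω_conn.nonempty hω_bdd hqc hqU hne,
    hne, m + 1, nodalCount_lift hω_conn hφ.continuousOn hφmono hφ0 hφ1 fun t ht => ?_, ?_⟩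
  · rw [hUz ht]
    exact hzφ t (Set.Ioo_subset_Icc_self ht)
  · obtain ⟨α, hα, hαr, hαθ⟩ := exists_eigenvalue_seq hqc hqU hΘ hΘ0
    refine ⟨α, hα, hαr, (strictMono_endAngle hqc hΘ hΘ0).lt_iff_lt.1 ?_⟩
    rw [hαθ]
    push_cast
    exact hhi
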